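/- Let $\mathscr{A}$ be a $\mathrm{DG}$-category, that is, a category enriched over the category of ($\mathbb{Z}$-graded, unbounded, homologically indexed) chain complexes of abelian groups. For objects $A,B$ of $\mathscr{A}$ let $$\tau_{\ge 0}\operatorname{Hom}_{\mathscr{A}}(A,B)_\bullet=\bigl(\cdots\to \operatorname{Hom}_{\mathscr{A}}(A,B)_1\to \operatorname{Ker}(\operatorname{Hom}_{\mathscr{A}}(A,B)_0\to \operatorname{Hom}_{\mathscr{A}}(A,B)_{-1})\to 0\to\cdots\bigr)$$ be the truncation of the Hom complex, and let $\operatorname{Map}_{\mathscr{A}}(A,B)$ be the underlying simplicial set of the simplicial abelian group corresponding to $\tau_{\ge 0}\operatorname{Hom}_{\mathscr{A}}(A,B)_\bullet$ under the Dold–Kan correspondence. Regard $\mathscr{A}$ as a simplicial category with the same objects, with mapping spaces $\operatorname{Map}_{\mathscr{A}}(A,B)$, and with the composition induced by that of $\mathscr{A}$ through the Alexander–Whitney map. Let $\mathrm{N}(\mathscr{A})$ be the homotopy coherent nerve of this simplicial category: its $n$-simplices are the simplicial functors $|\Delta^n|\to\mathscr{A}$, where $|\Delta^n|$ is the simplicial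 category with objects $0,\dots,n$ and with $\operatorname{Hom}_{|\Delta^n|}(k,m)$ the nerve of the poset, ordered by inclusion, of the subsets of $\{k,\dots,m\}$ containing both $k$ and $m$ if $k\le m$, and empty if $k>m$; composition in $|\Delta^n|$ is induced by union of subsets. Then $\mathrm{N}(\mathscr{A})$ is an $(\infty,1)$-category (quasicategory): for all $0<i<n$, every map of simplicial sets $\Lambda^n_i\to \mathrm{N}(\mathscr{A})$ extends to a map $\Delta^n\to \mathrm{N}(\mathscr{A})$. -/

import Mathlib

open CategoryTheory Simplicial

universe v u

/-- A DG-category: a category enriched over chain complexes of abelian groups, written out.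
`comp h g f` is the composite `g ∘ f` of `g : Y ⟶ Z` of degree `p` and `f : X ⟶ Y` of degree `q`;
it is biadditive, and the Leibniz rule (with the Koszul sign) says that
`Hom Y Z ⊗ Hom X Y ⟶ Hom X Z` is a chain map. -/
class DGCategory (A : Type u) where
  Hom : A → A → ChainComplex AddCommGrpCat.{v} ℤ
  id (X : A) : (Hom X X).X 0
  comp {X Y Z : A} {p q r : ℤ} (h : p + q = r) :
    (Hom Y Z).X p →+ (Hom X Y).X q →+ (Hom X Z).X r
  d_id (X : A) : (Hom X X).d 0 (-1) (id X) = 0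
  d_comp {X Y Z : A} {p q r : ℤ} (h : p + q = r) (g : (Hom Y Z).X p) (f : (Hom X Y).X q) :
    (Hom X Z).d r (r - 1) (comp h g f) =
      comp (by lia : p - 1 + q = r - 1) ((Hom Y Z).d p (p - 1) g) f +
        p.negOnePow • comp (by lia : p + (q - 1) = r - 1) g ((Hom X Y).d q (q - 1) f)
  id_comp {X Y : A} {p : ℤ} (f : (Hom X Y).X p) : comp (zero_add p) (id Y) f = f
  comp_id {X Y : A} {p : ℤ} (f : (Hom X Y).X p) : comp (add_zero p) f (id X) = f
  assoc {W X Y Z : A} {p q r : ℤ} (h : (Hom Y Z).X p) (g : (Hom X Y).X q) (f : (Hom W X).X r) :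
    comp rfl (comp rfl h g) f = comp (add_assoc p q r).symm h (comp rfl g f)

namespace DGCategory

/-- The monotone map `i ↦ min (φ i) m` from `{0, …, p}` to `{0, …, m}`. -/
def simplexMap (p m : ℕ) (φ : ℕ → ℕ) (hφ : Monotone φ) : ⦋p⦌ ⟶ ⦋m⦌ :=
  SimplexCategory.mkHom ⟨fun i ↦ ⟨min (φ i) m, by lia⟩, fun i j hij ↦ by
    have := hφ (show (i : ℕ) ≤ j from hij)
    simp only [Fin.mk_le_mk]; lia⟩

/-- The front face `{0, …, p} ⟶ {0, …, m}`, `i ↦ i`, used for `p ≤ m`. -/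
def front (p m : ℕ) : ⦋p⦌ ⟶ ⦋m⦌ := simplexMap p m (fun i ↦ i) (fun _ _ h ↦ h)

/-- The back face `{0, …, q} ⟶ {0, …, m}`, `i ↦ p + i`, used for `p + q = m`. -/
def back (p q m : ℕ) : ⦋q⦌ ⟶ ⦋m⦌ := simplexMap q m (fun i ↦ p + i) (fun _ _ h ↦ by dsimp; lia)

/-- The coface map omitting `k`, indexed by natural numbers (see `δ_eq_face`). -/
def face (m k : ℕ) : ⦋m⦌ ⟶ ⦋m + 1⦌ :=
  simplexMap m (m + 1) (fun i ↦ if i < k then i else i + 1) (fun i j h ↦ by dsimp; grind)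

lemma simplex_ext {p m : ℕ} {α β : ⦋p⦌ ⟶ ⦋m⦌}
    (h : ∀ i : Fin (p + 1), (α.toOrderHom i : ℕ) = β.toOrderHom i) : α = β := by
  ext i
  exact h i

lemma simplexMap_apply (p m : ℕ) (φ : ℕ → ℕ) (hφ : Monotone φ) (i : Fin (p + 1)) :
    (((simplexMap p m φ hφ).toOrderHom i : Fin (m + 1)) : ℕ) = min (φ i) m := rfl

lemma front_apply (p m : ℕ) (i : Fin (p + 1)) :
    (((front p m).toOrderHom i : Fin (m + 1)) : ℕ) = min (i : ℕ) m := rfl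

lemma back_apply (p q m : ℕ) (i : Fin (q + 1)) :
    (((back p q m).toOrderHom i : Fin (m + 1)) : ℕ) = min (p + i : ℕ) m := rfl

lemma face_apply (m k : ℕ) (i : Fin (m + 1)) :
    (((face m k).toOrderHom i : Fin (m + 2)) : ℕ) =
      min (if (i : ℕ) < k then (i : ℕ) else i + 1) (m + 1) := rfl

lemma δ_eq_face (m : ℕ) (k : Fin (m + 2)) : SimplexCategory.δ k = face m k := by
  apply simplex_ext
  intro i
  rw [face_apply]
  simp [SimplexCategory.δ, Fin.succAbove, Fin.lt_def]
  split_ifs <;> simp <;> lia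

/-- A chain map from the normalized chain complex of the standard `n`-simplex (with integral
coefficients) to `C`: an element of `C` of degree `p` for each `p`-simplex `σ` of the standard
`n`-simplex, vanishing on degenerate simplices and compatible with the differentials. -/
structure NCochain (C : ChainComplex AddCommGrpCat.{v} ℤ) (n : ℕ) where
  val : ∀ p : ℕ, (⦋p⦌ ⟶ ⦋n⦌) → C.X p
  degenerate : ∀ (p : ℕ) (σ : ⦋p⦌ ⟶ ⦋n⦌), ¬ Function.Injective σ.toOrderHom → val p σ = 0
  d_zero : ∀ σ : ⦋0⦌ ⟶ ⦋n⦌, C.d ((0 : ℕ) : ℤ) (-1) (val 0 σ) = 0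
  d_succ : ∀ (p : ℕ) (σ : ⦋p + 1⦌ ⟶ ⦋n⦌), C.d ((p + 1 : ℕ) : ℤ) p (val (p + 1) σ) =
    ∑ i : Fin (p + 2), (-1 : ℤ) ^ (i : ℕ) • val p (SimplexCategory.δ i ≫ σ)

namespace NCochain

variable {C : ChainComplex AddCommGrpCat.{v} ℤ} {n : ℕ}

@[ext]
lemma ext {f g : NCochain C n} (h : ∀ p σ, f.val p σ = g.val p σ) : f = g := by
  cases f; cases g; congr; funext p σ; exact h p σ

lemma d_succ' (f : NCochain C n) (p : ℕ) (σ : ⦋p + 1⦌ ⟶ ⦋n⦌) :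
    C.d ((p + 1 : ℕ) : ℤ) p (f.val (p + 1) σ) =
    ∑ i ∈ Finset.range (p + 2), (-1 : ℤ) ^ i • f.val p (face p i ≫ σ) := by
  rw [d_succ, ← Fin.sum_univ_eq_sum_range (fun i ↦ (-1 : ℤ) ^ i • f.val p (face p i ≫ σ))]
  simp only [δ_eq_face]

/-- Restriction along a simplicial operator. -/
def map {m : ℕ} (α : ⦋m⦌ ⟶ ⦋n⦌) (f : NCochain C n) : NCochain C m where
  val p σ := f.val p (σ ≫ α)
  degenerate p σ h := f.degenerate p _ (fun h' ↦ h (by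
    rw [SimplexCategory.comp_toOrderHom] at h'
    exact Function.Injective.of_comp h'))
  d_zero σ := f.d_zero _
  d_succ p σ := by simpa using f.d_succ p (σ ≫ α)

end NCochain

variable {A : Type u} [DGCategory.{v} A]

/-- The unit: the identity on each vertex, and zero on simplices of positive dimension. -/
def one (X : A) (n : ℕ) : NCochain (Hom X X) n where
  val p _ := match p with
    | 0 => DGCategory.id X
    | _ + 1 => 0
  degenerate p σ h := by
    rcases p with _ | p
    · exact (h (fun _ _ _ ↦ Subsingleton.elim (α := Fin 1) _ _)).elim
    · rfl
  d_zero σ := d_id X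
  d_succ p σ := by
    rcases p with _ | p
    · simp [Fin.sum_univ_succ]
    · simp

/-- Composition of morphisms whose degrees are natural numbers `p`, `q`, with a result in degree
`r`; the value is `0` unless `p + q = r` (only the case `p + q = r` is ever used). -/
def natComp {X Y Z : A} (p q r : ℕ) (g : (Hom Y Z).X p) (f : (Hom X Y).X q) : (Hom X Z).X r :=
  if h : (p : ℤ) + q = r then comp h g f else 0

/-- The composition of two families through the Alexander-Whitney map:
`(g ∪ f)(σ) = ∑_{p + q = m} g(front p-face of σ) ∘ f(back q-face of σ)`. -/
def cupVal {X Y Z : A} {n : ℕ} (g : NCochain (Hom Y Z) n) (f : NCochain (Hom X Y) n)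
    (m : ℕ) (σ : ⦋m⦌ ⟶ ⦋n⦌) : (Hom X Z).X m :=
  ∑ x ∈ Finset.HasAntidiagonal.antidiagonal m,
    natComp x.1 x.2 m (g.val x.1 (front x.1 m ≫ σ)) (f.val x.2 (back x.1 x.2 m ≫ σ))

lemma inj_of_lt {m n : ℕ} (σ : ⦋m⦌ ⟶ ⦋n⦌)
    (h : ∀ i (hi : i < m), σ.toOrderHom ⟨i, by simp; lia⟩ ≠ σ.toOrderHom ⟨i + 1, by simp; lia⟩) :
    Function.Injective σ.toOrderHom := by
  apply StrictMono.injective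
  rw [Fin.strictMono_iff_lt_succ]
  intro i
  exact lt_of_le_of_ne (σ.toOrderHom.monotone (Fin.castSucc_lt_succ).le) (h i i.2)

lemma mul_zero_left {X Y Z : A} (p q r : ℕ) (f : (Hom X Y).X q) :
    natComp p q r (0 : (Hom Y Z).X p) f = 0 := by
  unfold natComp; split_ifs <;> simp

lemma mul_zero_right {X Y Z : A} (p q r : ℕ) (g : (Hom Y Z).X p) :
    natComp p q r g (0 : (Hom X Y).X q) = 0 := by
  unfold natComp; split_ifs <;> simp

lemma mul_sum_left {X Y Z : A} (p q r : ℕ) {ι : Type} (s : Finset ι) (a : ι → ℤ)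
    (g : ι → (Hom Y Z).X p) (f : (Hom X Y).X q) :
    natComp p q r (∑ i ∈ s, a i • g i) f = ∑ i ∈ s, a i • natComp p q r (g i) f := by
  unfold natComp; split_ifs <;> simp

lemma mul_sum_right {X Y Z : A} (p q r : ℕ) {ι : Type} (s : Finset ι) (a : ι → ℤ)
    (g : (Hom Y Z).X p) (f : ι → (Hom X Y).X q) :
    natComp p q r g (∑ i ∈ s, a i • f i) = ∑ i ∈ s, a i • natComp p q r g (f i) := by
  unfold natComp; split_ifs <;> simp

lemma cup_degenerate {X Y Z : A} {n : ℕ} (g : NCochain (Hom Y Z) n) (f : NCochain (Hom X Y) n)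
    (m : ℕ) (σ : ⦋m⦌ ⟶ ⦋n⦌) (h : ¬ Function.Injective σ.toOrderHom) : cupVal g f m σ = 0 := by
  obtain ⟨i, hi, h⟩ : ∃ i, ∃ hi : i < m,
      σ.toOrderHom ⟨i, by simp; lia⟩ = σ.toOrderHom ⟨i + 1, by simp; lia⟩ := by
    by_contra! h'
    exact h (inj_of_lt σ h')
  refine Finset.sum_eq_zero fun x hx ↦ ?_
  obtain ⟨p, q⟩ := x
  simp only [Finset.HasAntidiagonal.mem_antidiagonal] at hx
  subst hx
  by_cases hip : i < p
  · rw [g.degenerate, mul_zero_left]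
    intro hinj
    have := @hinj ⟨i, by simp; lia⟩ ⟨i + 1, by simp; lia⟩ (by
      simp only [SimplexCategory.comp_toOrderHom, OrderHom.comp_coe, Function.comp_apply]
      convert h using 2 <;> ext <;> simp only [front_apply] <;> lia)
    simp at this
  · rw [f.degenerate, mul_zero_right]
    intro hinj
    have := @hinj ⟨i - p, by simp; lia⟩ ⟨i - p + 1, by simp; lia⟩ (by
      simp only [SimplexCategory.comp_toOrderHom, OrderHom.comp_coe, Function.comp_apply]
      convert h using 2 <;> ext <;> simp only [back_apply] <;> lia)
    simp at this


lemma d_comp' {X Y Z : A} {p q r p' q' r' : ℤ} (h : p + q = r) (hp : p' + 1 = p)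
    (hq : q' + 1 = q) (hr : r' + 1 = r) (g : (Hom Y Z).X p) (f : (Hom X Y).X q) :
    (Hom X Z).d r r' (comp h g f) =
      comp (by lia : p' + q = r') ((Hom Y Z).d p p' g) f +
        p.negOnePow • comp (by lia : p + q' = r') g ((Hom X Y).d q q' f) := by
  obtain rfl : p' = p - 1 := by lia
  obtain rfl : q' = q - 1 := by lia
  obtain rfl : r' = r - 1 := by lia
  exact d_comp h g f

lemma negOnePow_smul {M : Type*} [AddCommGroup M] (p : ℕ) (x : M) :
    ((p : ℤ).negOnePow : ℤˣ) • x = (-1 : ℤ) ^ p • x := by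
  rw [Units.smul_def]; simp [Int.negOnePow_def]

lemma d_mul_zero {X Y Z : A} (g : (Hom Y Z).X (0 : ℕ)) (f : (Hom X Y).X (0 : ℕ))
    (hg : (Hom Y Z).d ((0 : ℕ) : ℤ) (-1) g = 0) (hf : (Hom X Y).d ((0 : ℕ) : ℤ) (-1) f = 0) :
    (Hom X Z).d ((0 : ℕ) : ℤ) (-1) (natComp 0 0 0 g f) = 0 := by
  rw [natComp, dif_pos (by simp), d_comp' (p' := -1) (q' := -1) _ (by simp) (by simp) (by simp), hg, hf]
  simp

lemma d_mul_zero_succ {X Y Z : A} (m : ℕ) (g : (Hom Y Z).X (0 : ℕ)) (f : (Hom X Y).X (m + 1 : ℕ))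
    (hg : (Hom Y Z).d ((0 : ℕ) : ℤ) (-1) g = 0) :
    (Hom X Z).d ((m + 1 : ℕ) : ℤ) m (natComp 0 (m + 1) (m + 1) g f) =
      (-1 : ℤ) ^ 0 • natComp 0 m m g ((Hom X Y).d ((m + 1 : ℕ) : ℤ) m f) := by
  rw [natComp, dif_pos (by simp), d_comp' (p' := -1) (q' := m) _ (by simp) (by simp) (by simp), hg,
    natComp, dif_pos (by simp), negOnePow_smul]
  simp

lemma d_mul_succ_zero {X Y Z : A} (m : ℕ) (g : (Hom Y Z).X (m + 1 : ℕ)) (f : (Hom X Y).X (0 : ℕ))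
    (hf : (Hom X Y).d ((0 : ℕ) : ℤ) (-1) f = 0) :
    (Hom X Z).d ((m + 1 : ℕ) : ℤ) m (natComp (m + 1) 0 (m + 1) g f) =
      natComp m 0 m ((Hom Y Z).d ((m + 1 : ℕ) : ℤ) m g) f := by
  rw [natComp, dif_pos (by simp), d_comp' (p' := m) (q' := -1) _ (by simp) (by simp) (by simp), hf,
    natComp, dif_pos (by simp)]
  simp

lemma d_mul_succ_succ {X Y Z : A} (a b m : ℕ) (h : a + 1 + (b + 1) = m + 1)
    (g : (Hom Y Z).X (a + 1 : ℕ)) (f : (Hom X Y).X (b + 1 : ℕ)) :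
    (Hom X Z).d ((m + 1 : ℕ) : ℤ) m (natComp (a + 1) (b + 1) (m + 1) g f) =
      natComp a (b + 1) m ((Hom Y Z).d ((a + 1 : ℕ) : ℤ) a g) f +
      (-1 : ℤ) ^ (a + 1) • natComp (a + 1) b m g ((Hom X Y).d ((b + 1 : ℕ) : ℤ) b f) := by
  rw [natComp, dif_pos (by simp; lia), d_comp' (p' := a) (q' := b) _ (by simp) (by simp) (by simp),
    natComp, dif_pos (by simp; lia), natComp, dif_pos (by simp; lia), negOnePow_smul]

lemma cup_d_zero {X Y Z : A} {n : ℕ} (g : NCochain (Hom Y Z) n) (f : NCochain (Hom X Y) n)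
    (σ : ⦋0⦌ ⟶ ⦋n⦌) : (Hom X Z).d ((0 : ℕ) : ℤ) (-1) (cupVal g f 0 σ) = 0 := by
  simp only [cupVal, Finset.Nat.antidiagonal_zero, Finset.sum_singleton]
  exact d_mul_zero _ _ (g.d_zero _) (f.d_zero _)

/-- Splitting of the Leibniz rule over the decompositions of `m + 1`. -/
lemma sum_split {M : Type*} [AddCommGroup M] (m : ℕ) (D L R : ℕ → ℕ → M)
    (h0 : D 0 (m + 1) = R 0 m) (h1 : D (m + 1) 0 = L m 0)
    (h : ∀ a b, a + 1 + (b + 1) = m + 1 → D (a + 1) (b + 1) = L a (b + 1) + R (a + 1) b) :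
    ∑ x ∈ Finset.HasAntidiagonal.antidiagonal (m + 1), D x.1 x.2 =
      ∑ x ∈ Finset.HasAntidiagonal.antidiagonal m, (L x.1 x.2 + R x.1 x.2) := by
  rcases m with _ | m
  · simp [Finset.Nat.antidiagonal_succ, h0, h1, add_comm]
  · rw [Finset.Nat.sum_antidiagonal_succ, Finset.Nat.sum_antidiagonal_succ', Finset.sum_add_distrib,
      Finset.Nat.sum_antidiagonal_succ', Finset.Nat.sum_antidiagonal_succ (f := fun x ↦ R x.1 x.2)]
    dsimp only
    rw [h0, h1, Finset.sum_congr rfl (g := fun x ↦ L x.1 (x.2 + 1) + R (x.1 + 1) x.2),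
      Finset.sum_add_distrib]
    · abel
    · intro x hx
      simp only [Finset.HasAntidiagonal.mem_antidiagonal] at hx
      exact h _ _ (by lia)

lemma face_front_lt (a b k : ℕ) (h : k ≤ a) :
    front a (a + b) ≫ face (a + b) k = face a k ≫ front (a + 1) (a + b + 1) := by
  apply simplex_ext
  intro i
  simp only [SimplexCategory.comp_toOrderHom, OrderHom.comp_coe, Function.comp_apply, front_apply,
    face_apply]
  split_ifs <;> lia

lemma face_back_lt (a b k : ℕ) (h : k ≤ a) :
    back a b (a + b) ≫ face (a + b) k = back (a + 1) b (a + b + 1) := by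
  apply simplex_ext
  intro i
  simp only [SimplexCategory.comp_toOrderHom, OrderHom.comp_coe, Function.comp_apply, back_apply,
    face_apply]
  split_ifs <;> lia

lemma face_front_ge (a b k : ℕ) :
    front a (a + b) ≫ face (a + b) (a + 1 + k) = front a (a + b + 1) := by
  apply simplex_ext
  intro i
  simp only [SimplexCategory.comp_toOrderHom, OrderHom.comp_coe, Function.comp_apply, front_apply,
    face_apply]
  split_ifs <;> lia

lemma face_back_ge (a b k : ℕ) :
    back a b (a + b) ≫ face (a + b) (a + 1 + k) =
      face b (k + 1) ≫ back a (b + 1) (a + b + 1) := by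
  apply simplex_ext
  intro i
  simp only [SimplexCategory.comp_toOrderHom, OrderHom.comp_coe, Function.comp_apply, back_apply,
    face_apply]
  split_ifs <;> lia

lemma face_front_last (a m : ℕ) : face a (a + 1) ≫ front (a + 1) m = front a m := by
  apply simplex_ext
  intro i
  simp only [SimplexCategory.comp_toOrderHom, OrderHom.comp_coe, Function.comp_apply, front_apply,
    face_apply]
  split_ifs <;> lia

lemma face_back_first (a b m : ℕ) : face b 0 ≫ back a (b + 1) m = back (a + 1) b m := by
  apply simplex_ext
  intro i
  simp only [SimplexCategory.comp_toOrderHom, OrderHom.comp_coe, Function.comp_apply, back_apply,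
    face_apply]
  split_ifs <;> lia

lemma cup_d_succ {X Y Z : A} {n : ℕ} (g : NCochain (Hom Y Z) n) (f : NCochain (Hom X Y) n)
    (m : ℕ) (σ : ⦋m + 1⦌ ⟶ ⦋n⦌) :
    (Hom X Z).d ((m + 1 : ℕ) : ℤ) m (cupVal g f (m + 1) σ) =
      ∑ i ∈ Finset.range (m + 2), (-1 : ℤ) ^ i • cupVal g f m (face m i ≫ σ) := by
  rw [cupVal, map_sum]
  rw [sum_split m (fun p q ↦ (Hom X Z).d ((m + 1 : ℕ) : ℤ) m
      (natComp p q (m + 1) (g.val p (front p (m + 1) ≫ σ)) (f.val q (back p q (m + 1) ≫ σ))))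
    (fun a b ↦ natComp a b m ((Hom Y Z).d ((a + 1 : ℕ) : ℤ) a
      (g.val (a + 1) (front (a + 1) (m + 1) ≫ σ))) (f.val b (back (a + 1) b (m + 1) ≫ σ)))
    (fun a b ↦ (-1 : ℤ) ^ a • natComp a b m (g.val a (front a (m + 1) ≫ σ))
      ((Hom X Y).d ((b + 1 : ℕ) : ℤ) b (f.val (b + 1) (back a (b + 1) (m + 1) ≫ σ))))
    (d_mul_zero_succ _ _ _ (g.d_zero _)) (d_mul_succ_zero _ _ _ (f.d_zero _))
    (fun a b h ↦ d_mul_succ_succ a b m h _ _)]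
  simp only [cupVal, Finset.smul_sum]
  rw [Finset.sum_comm]
  refine Finset.sum_congr rfl fun x hx ↦ ?_
  obtain ⟨a, b⟩ := x
  simp only [Finset.HasAntidiagonal.mem_antidiagonal] at hx
  subst hx
  dsimp only
  rw [g.d_succ', f.d_succ', mul_sum_left, mul_sum_right, Finset.sum_range_succ _ (a + 1),
    Finset.sum_range_succ' _ (b + 1), show a + b + 2 = (a + 1) + (b + 1) by lia,
    Finset.sum_range_add _ (a + 1) (b + 1), smul_add, Finset.smul_sum]
  simp only [← Category.assoc, face_front_last, face_back_first, face_front_ge, face_back_ge]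
  have h1 : ∀ i ∈ Finset.range (a + 1),
      (-1 : ℤ) ^ i • natComp a b (a + b) (g.val a ((front a (a + b) ≫ face (a + b) i) ≫ σ))
        (f.val b ((back a b (a + b) ≫ face (a + b) i) ≫ σ)) =
      (-1 : ℤ) ^ i • natComp a b (a + b) (g.val a ((face a i ≫ front (a + 1) (a + b + 1)) ≫ σ))
        (f.val b (back (a + 1) b (a + b + 1) ≫ σ)) := by
    intro i hi
    have hi' : i ≤ a := by simp at hi; lia
    rw [face_front_lt a b i hi', face_back_lt a b i hi']
  rw [Finset.sum_congr rfl h1]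
  simp only [smul_smul, ← pow_add, pow_zero, mul_one]
  have h2 : ∀ i, (-1 : ℤ) ^ (a + (i + 1)) = (-1) ^ (a + 1 + i) := fun i ↦ by congr 1; lia
  simp only [h2]
  rw [pow_succ (-1 : ℤ) a]
  simp only [mul_neg, mul_one, neg_smul]
  abel

/-- The composition through the Alexander-Whitney map, as a chain map. -/
def cup {X Y Z : A} {n : ℕ} (g : NCochain (Hom Y Z) n) (f : NCochain (Hom X Y) n) :
    NCochain (Hom X Z) n where
  val := cupVal g f
  degenerate := cup_degenerate g f
  d_zero := cup_d_zero g f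
  d_succ m σ := by
    rw [cup_d_succ, ← Fin.sum_univ_eq_sum_range (fun i ↦ (-1 : ℤ) ^ i • cupVal g f m (face m i ≫ σ))]
    simp only [δ_eq_face]

lemma cup_map {X Y Z : A} {n n' : ℕ} (g : NCochain (Hom Y Z) n) (f : NCochain (Hom X Y) n)
    (α : ⦋n'⦌ ⟶ ⦋n⦌) : (cup g f).map α = cup (g.map α) (f.map α) := by
  ext m σ
  simp [cup, NCochain.map, cupVal]

lemma one_map (X : A) {n n' : ℕ} (α : ⦋n'⦌ ⟶ ⦋n⦌) : (one X n).map α = one X n' := by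
  ext p σ
  rcases p with _ | p <;> rfl

lemma mul_one_right {X Y : A} (p : ℕ) (g : (Hom X Y).X p) :
    natComp p 0 p g (DGCategory.id X : (Hom X X).X ((0 : ℕ) : ℤ)) = g := by
  rw [natComp, dif_pos (by simp)]
  exact DGCategory.comp_id g

lemma mul_one_left {X Y : A} (p : ℕ) (g : (Hom X Y).X p) :
    natComp 0 p p (DGCategory.id Y : (Hom Y Y).X ((0 : ℕ) : ℤ)) g = g := by
  rw [natComp, dif_pos (by simp)]
  exact DGCategory.id_comp g

lemma front_self (m : ℕ) : front m m = 𝟙 _ := by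
  apply simplex_ext
  intro i
  rw [front_apply]
  simp; lia

lemma back_self (m : ℕ) : back 0 m m = 𝟙 _ := by
  apply simplex_ext
  intro i
  rw [back_apply]
  simp; lia

lemma cup_one {X Y : A} {n : ℕ} (g : NCochain (Hom X Y) n) : cup g (one X n) = g := by
  ext m σ
  change cupVal _ _ _ _ = _
  rw [cupVal, Finset.sum_eq_single (m, 0)]
  · dsimp only [one]
    rw [mul_one_right, front_self, Category.id_comp]
  · rintro ⟨p, q⟩ hx hne
    rcases q with _ | q
    · simp at hx; subst hx; exact (hne rfl).elim
    · exact mul_zero_right _ _ _ _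
  · simp

lemma one_cup {X Y : A} {n : ℕ} (g : NCochain (Hom X Y) n) : cup (one Y n) g = g := by
  ext m σ
  change cupVal _ _ _ _ = _
  rw [cupVal, Finset.sum_eq_single (0, m)]
  · dsimp only [one]
    rw [mul_one_left, back_self, Category.id_comp]
  · rintro ⟨p, q⟩ hx hne
    rcases p with _ | p
    · simp at hx; subst hx; exact (hne rfl).elim
    · exact mul_zero_left _ _ _ _
  · simp

lemma mul_assoc' {W X Y Z : A} (p q r s t m : ℕ) (hs : p + q = s) (ht : q + r = t)
    (h : (Hom Y Z).X p) (g : (Hom X Y).X q) (f : (Hom W X).X r) :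
    natComp s r m (natComp p q s h g) f = natComp p t m h (natComp q r t g f) := by
  subst hs ht
  by_cases hm : p + q + r = m
  · subst hm
    have key : ∀ {p q r s t m : ℤ} (hs : p + q = s) (ht : q + r = t) (h1 : s + r = m)
        (h2 : p + t = m) (h : (Hom Y Z).X p) (g : (Hom X Y).X q) (f : (Hom W X).X r),
        comp h1 (comp hs h g) f = comp h2 h (comp ht g f) := by
      intro p q r s t m hs ht h1 h2 h g f
      subst hs ht h1
      exact DGCategory.assoc h g f
    simp only [natComp]
    rw [dif_pos (by simp), dif_pos (by simp), dif_pos (by simp; lia), dif_pos (by simp)]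
    exact key _ _ _ _ _ _ _
  · simp only [natComp]
    rw [dif_neg (by lia), dif_neg (by lia)]

lemma mul_sum_left' {X Y Z : A} (p q r : ℕ) {ι : Type} (s : Finset ι)
    (g : ι → (Hom Y Z).X p) (f : (Hom X Y).X q) :
    natComp p q r (∑ i ∈ s, g i) f = ∑ i ∈ s, natComp p q r (g i) f := by
  unfold natComp; split_ifs <;> simp

lemma mul_sum_right' {X Y Z : A} (p q r : ℕ) {ι : Type} (s : Finset ι)
    (g : (Hom Y Z).X p) (f : ι → (Hom X Y).X q) :
    natComp p q r g (∑ i ∈ s, f i) = ∑ i ∈ s, natComp p q r g (f i) := by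
  unfold natComp; split_ifs <;> simp

lemma cup_assoc {W X Y Z : A} {n : ℕ} (h : NCochain (Hom Y Z) n) (g : NCochain (Hom X Y) n)
    (f : NCochain (Hom W X) n) : cup (cup h g) f = cup h (cup g f) := by
  ext m σ
  change cupVal _ _ _ _ = cupVal _ _ _ _
  simp only [cupVal]
  simp only [cup, cupVal, mul_sum_left', mul_sum_right']
  rw [Finset.sum_sigma', Finset.sum_sigma']
  refine Finset.sum_nbij' (fun x ↦ ⟨(x.2.1, x.2.2 + x.1.2), (x.2.2, x.1.2)⟩)
    (fun x ↦ ⟨(x.1.1 + x.2.1, x.2.2), (x.1.1, x.2.1)⟩) ?_ ?_ ?_ ?_ ?_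
  · rintro ⟨⟨s, r⟩, ⟨p, q⟩⟩ hx
    simp at hx ⊢; lia
  · rintro ⟨⟨p, t⟩, ⟨q, r⟩⟩ hx
    simp at hx ⊢; lia
  · rintro ⟨⟨s, r⟩, ⟨p, q⟩⟩ hx
    simp at hx ⊢; lia
  · rintro ⟨⟨p, t⟩, ⟨q, r⟩⟩ hx
    simp at hx ⊢; lia
  · rintro ⟨⟨s, r⟩, ⟨p, q⟩⟩ hx
    simp only [Finset.mem_sigma, Finset.HasAntidiagonal.mem_antidiagonal] at hx
    obtain ⟨rfl, rfl⟩ := hx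
    dsimp only
    rw [mul_assoc' p q r (p + q) (q + r) _ rfl rfl]
    have e1 : front p (p + q) ≫ front (p + q) (p + q + r) = front p (p + q + r) := by
      apply simplex_ext
      intro i
      simp only [SimplexCategory.comp_toOrderHom, OrderHom.comp_coe, Function.comp_apply,
        front_apply]
      lia
    have e2 : back p q (p + q) ≫ front (p + q) (p + q + r) =
        front q (q + r) ≫ back p (q + r) (p + q + r) := by
      apply simplex_ext
      intro i
      simp only [SimplexCategory.comp_toOrderHom, OrderHom.comp_coe, Function.comp_apply,
        front_apply, back_apply]
      lia
    have e3 : back q r (q + r) ≫ back p (q + r) (p + q + r) = back (p + q) r (p + q + r) := by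
      apply simplex_ext
      intro i
      simp only [SimplexCategory.comp_toOrderHom, OrderHom.comp_coe, Function.comp_apply,
        back_apply]
      lia
    simp only [← Category.assoc, e1, e2, e3]



/-- The inclusion of the degrees `n ≥ 0` into all integers. -/
def natEmbedding : (ComplexShape.down ℕ).Embedding (ComplexShape.down ℤ) where
  f n := n
  injective_f _ _ h := by simpa using h
  rel h := by simp only [ComplexShape.down_Rel] at h ⊢; lia

lemma natEmbedding_f (n : ℕ) : natEmbedding.f n = n := rfl

instance : natEmbedding.IsRelIff where
  rel' i j h := by simp only [natEmbedding_f, ComplexShape.down_Rel] at h ⊢; lia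

instance : natEmbedding.IsTruncLE where
  mem_prev {i' j} h := ⟨j + 1, by
    simp only [natEmbedding_f, ComplexShape.down_Rel] at h ⊢
    lia⟩

/-- The canonical truncation of a chain complex to nonnegative degrees: the cycles in degree `0`,
and the terms of the complex itself in positive degrees. -/
noncomputable def trunc (C : ChainComplex AddCommGrpCat.{v} ℤ) : ChainComplex AddCommGrpCat.{v} ℕ :=
  C.truncLE' natEmbedding

/-- The inclusion of the truncation. -/
noncomputable def truncι (C : ChainComplex AddCommGrpCat.{v} ℤ) (p : ℕ) : (trunc C).X p ⟶ C.X p :=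
  (C.truncLE'ToRestriction natEmbedding).f p

instance (C : ChainComplex AddCommGrpCat.{v} ℤ) (p : ℕ) : Mono (truncι C p) :=
  inferInstanceAs (Mono ((C.truncLE'ToRestriction natEmbedding).f p))

lemma truncι_injective (C : ChainComplex AddCommGrpCat.{v} ℤ) (p : ℕ) :
    Function.Injective (truncι C p) :=
  (AddCommGrpCat.mono_iff_injective _).1 inferInstance

lemma truncι_d (C : ChainComplex AddCommGrpCat.{v} ℤ) (p q : ℕ) :
    truncι C p ≫ C.d p q = (trunc C).d p q ≫ truncι C q :=
  (C.truncLE'ToRestriction natEmbedding).comm p q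

lemma boundaryLE_zero : natEmbedding.BoundaryLE 0 := by
  apply ComplexShape.Embedding.boundaryLE (k' := -1)
  · simp [natEmbedding_f]
  · intro i
    simp only [natEmbedding_f]
    lia

lemma not_boundaryLE_succ (p : ℕ) : ¬ natEmbedding.BoundaryLE (p + 1) :=
  ComplexShape.Embedding.not_boundaryLE_prev natEmbedding (j := p) (by simp)

lemma truncι_succ_surjective (C : ChainComplex AddCommGrpCat.{v} ℤ) (p : ℕ) :
    Function.Surjective (truncι C (p + 1)) := by
  have : IsIso (truncι C (p + 1)) :=
    C.isIso_truncLE'ToRestriction natEmbedding (p + 1) (not_boundaryLE_succ p)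
  exact (AddCommGrpCat.epi_iff_surjective _).1 inferInstance

lemma exists_truncι_zero_op (C : ChainComplex AddCommGrpCat.{v} ℤ) :
    ∃ (Q : AddCommGrpCat.{v}ᵒᵖ) (π : Opposite.op (C.X ((0 : ℕ) : ℤ)) ⟶ Q)
      (e : Q ≅ Opposite.op ((trunc C).X 0)), (truncι C 0).op = π ≫ e.hom ∧
        (C.d ((0 : ℕ) : ℤ) (-1)).op ≫ π = 0 ∧
        ∀ (T : AddCommGrpCat.{v}ᵒᵖ) (k : Opposite.op (C.X ((0 : ℕ) : ℤ)) ⟶ T),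
          (C.d ((0 : ℕ) : ℤ) (-1)).op ≫ k = 0 → ∃ l : Q ⟶ T, π ≫ l = k := by
  have h := C.op.restrictionToTruncGE'_f_eq_iso_hom_pOpcycles_iso_inv natEmbedding.op
    (i := 0) (i' := ((0 : ℕ) : ℤ)) rfl (by simpa using boundaryLE_zero)
  exact ⟨C.op.opcycles ((0 : ℕ) : ℤ), C.op.pOpcycles ((0 : ℕ) : ℤ),
    (C.op.truncGE'XIsoOpcycles natEmbedding.op (i := 0) (i' := ((0 : ℕ) : ℤ)) rfl
      (by simpa using boundaryLE_zero)).symm, h.trans (Category.id_comp _),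
    C.op.d_pOpcycles _ _, fun T k hk ↦ ⟨C.op.descOpcycles k (-1)
      ((ComplexShape.down ℤ).next_eq' (by simp)) hk, C.op.p_descOpcycles _ _ _ _⟩⟩

lemma truncι_zero_comp_d (C : ChainComplex AddCommGrpCat.{v} ℤ) :
    truncι C 0 ≫ C.d ((0 : ℕ) : ℤ) (-1) = 0 := by
  obtain ⟨Q, π, e, he, h0, -⟩ := exists_truncι_zero_op C
  apply Quiver.Hom.op_inj
  rw [op_comp, he, ← Category.assoc, h0, Limits.zero_comp]
  rfl

lemma exists_truncι_zero_lift (C : ChainComplex AddCommGrpCat.{v} ℤ) {T : AddCommGrpCat.{v}}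
    (k : T ⟶ C.X ((0 : ℕ) : ℤ)) (hk : k ≫ C.d ((0 : ℕ) : ℤ) (-1) = 0) :
    ∃ l : T ⟶ (trunc C).X 0, l ≫ truncι C 0 = k := by
  obtain ⟨Q, π, e, he, -, h1⟩ := exists_truncι_zero_op C
  obtain ⟨l, hl⟩ := h1 _ k.op (by rw [← op_comp, hk]; rfl)
  refine ⟨(e.inv ≫ l).unop, ?_⟩
  apply Quiver.Hom.op_inj
  rw [op_comp, he, Category.assoc, Quiver.Hom.op_unop, Iso.hom_inv_id_assoc, hl]

lemma range_truncι_zero (C : ChainComplex AddCommGrpCat.{v} ℤ) (c : C.X ((0 : ℕ) : ℤ))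
    (hc : C.d ((0 : ℕ) : ℤ) (-1) c = 0) : ∃ x : (trunc C).X 0, truncι C 0 x = c := by
  let T : AddCommGrpCat.{v} := AddCommGrpCat.of (C.d ((0 : ℕ) : ℤ) (-1)).hom.ker
  obtain ⟨l, hl⟩ := exists_truncι_zero_lift C (T := T)
    (AddCommGrpCat.ofHom (C.d ((0 : ℕ) : ℤ) (-1)).hom.ker.subtype) (by ext x; exact x.2)
  exact ⟨l ⟨c, hc⟩, ConcreteCategory.congr_hom hl _⟩

lemma d_truncι_zero (C : ChainComplex AddCommGrpCat.{v} ℤ) (x : (trunc C).X 0) :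
    C.d ((0 : ℕ) : ℤ) (-1) (truncι C 0 x) = 0 := by
  rw [← ConcreteCategory.comp_apply, truncι_zero_comp_d]; rfl

lemma d_truncι (C : ChainComplex AddCommGrpCat.{v} ℤ) (p q : ℕ) (x : (trunc C).X p) :
    C.d p q (truncι C p x) = truncι C q ((trunc C).d p q x) :=
  ConcreteCategory.congr_hom (truncι_d C p q) x


open AlgebraicTopology AlgebraicTopology.DoldKan Opposite

/-- The projection of the alternating face map complex onto the normalized Moore complex. -/
noncomputable def mooreProj (X : SimplicialObject AddCommGrpCat.{v}) :
    (alternatingFaceMapComplex _).obj X ⟶ (normalizedMooreComplex _).obj X :=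
  PInftyToNormalizedMooreComplex X

/-- The inclusion of the normalized Moore complex. -/
noncomputable def mooreIncl (X : SimplicialObject AddCommGrpCat.{v}) :
    (normalizedMooreComplex _).obj X ⟶ (alternatingFaceMapComplex _).obj X :=
  inclusionOfMooreComplexMap X

lemma mooreIncl_comp_mooreProj (X : SimplicialObject AddCommGrpCat.{v}) :
    mooreIncl X ≫ mooreProj X = 𝟙 _ :=
  (splitMonoInclusionOfMooreComplexMap X).id

lemma mooreProj_comp_mooreIncl (X : SimplicialObject AddCommGrpCat.{v}) :
    mooreProj X ≫ mooreIncl X = PInfty :=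
  PInftyToNormalizedMooreComplex_comp_inclusionOfMooreComplexMap X

lemma mooreProj_naturality {X Y : SimplicialObject AddCommGrpCat.{v}} (θ : X ⟶ Y) :
    (alternatingFaceMapComplex _).map θ ≫ mooreProj Y =
      mooreProj X ≫ (normalizedMooreComplex _).map θ :=
  PInftyToNormalizedMooreComplex_naturality θ

lemma σ_comp_mooreProj (X : SimplicialObject AddCommGrpCat.{v}) (n : ℕ) (i : Fin (n + 1)) :
    X.σ i ≫ (mooreProj X).f (n + 1) = 0 := by
  have h : (PInfty : (alternatingFaceMapComplex _).obj X ⟶ _) ≫ mooreProj X = mooreProj X :=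
    PInfty_comp_PInftyToNormalizedMooreComplex X
  rw [← h, HomologicalComplex.comp_f]
  exact (σ_comp_PInfty_assoc X i _).trans Limits.zero_comp

/-- The isomorphism `N Γ D ≅ D` of the Dold-Kan equivalence. -/
noncomputable def mooreΓIso (D : ChainComplex AddCommGrpCat.{v} ℕ) :
    (normalizedMooreComplex _).obj (Abelian.DoldKan.Γ.obj D) ≅ D :=
  (Abelian.DoldKan.equivalence (A := AddCommGrpCat.{v})).counitIso.app D

/-- The projection of `Γ D` onto `N Γ D ≅ D`. -/
noncomputable def dkCounit (D : ChainComplex AddCommGrpCat.{v} ℕ) :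
    (alternatingFaceMapComplex _).obj (Abelian.DoldKan.Γ.obj D) ⟶ D :=
  mooreProj _ ≫ (mooreΓIso D).hom

lemma sum_smul_apply {ι : Type} (s : Finset ι) {B B' : AddCommGrpCat.{v}} (a : ι → ℤ)
    (f : ι → (B ⟶ B')) (x : B) : (∑ i ∈ s, a i • f i) x = ∑ i ∈ s, a i • f i x := by
  induction s using Finset.cons_induction with
  | empty => rfl
  | cons i s hi ih => rw [Finset.sum_cons, Finset.sum_cons, ← ih]; rfl

/-- The free simplicial abelian group on the standard `n`-simplex. -/
noncomputable def freeSimplex (n : ℕ) : SimplicialObject AddCommGrpCat.{v} :=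
  uliftYoneda.{v}.obj ⦋n⦌ ⋙ AddCommGrpCat.free

/-- The generator of `freeSimplex n` given by a simplex. -/
noncomputable def gen {n : ℕ} {m : SimplexCategory} (σ : m ⟶ ⦋n⦌) :
    ((freeSimplex.{v} n).obj (op m) : Type v) :=
  FreeAbelianGroup.of (ULift.up σ)

lemma map_gen {n : ℕ} {m m' : SimplexCategory} (σ : m ⟶ ⦋n⦌) (α : m' ⟶ m) :
    (freeSimplex.{v} n).map α.op (gen σ) = gen (α ≫ σ) := by
  exact FreeAbelianGroup.map_of_apply _

/-- The homomorphism given by its values on generators. -/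
noncomputable def freeLift {n : ℕ} {m : SimplexCategory} {B : AddCommGrpCat.{v}} (φ : (m ⟶ ⦋n⦌) → B) :
   (freeSimplex.{v} n).obj (op m) ⟶ B :=
  AddCommGrpCat.ofHom (FreeAbelianGroup.lift (fun s ↦ φ s.down) : FreeAbelianGroup _ →+ B)

lemma freeLift_gen {n : ℕ} {m : SimplexCategory} {B : AddCommGrpCat.{v}} (φ : (m ⟶ ⦋n⦌) → B)
    (σ : m ⟶ ⦋n⦌) : freeLift φ (gen σ) = φ σ :=
  FreeAbelianGroup.lift_apply_of _ _

lemma free_hom_ext {n : ℕ} {m : SimplexCategory} {B : AddCommGrpCat.{v}}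
    {φ ψ : (freeSimplex.{v} n).obj (op m) ⟶ B} (h : ∀ σ, φ (gen σ) = ψ (gen σ)) : φ = ψ := by
  apply AddCommGrpCat.hom_ext
  apply FreeAbelianGroup.lift_ext
  rintro ⟨σ⟩
  exact h σ

/-- The morphism out of `freeSimplex n` given by an `n`-simplex. -/
noncomputable def freeYoneda {n : ℕ} (S : SimplicialObject AddCommGrpCat.{v}) (x : S.obj (op ⦋n⦌)) :
    freeSimplex.{v} n ⟶ S where
  app m := freeLift (fun σ ↦ S.map σ.op x)
  naturality := by
    rintro ⟨m⟩ ⟨m'⟩ ⟨α : m' ⟶ m⟩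
    apply free_hom_ext
    intro σ
    rw [ConcreteCategory.comp_apply, ConcreteCategory.comp_apply]
    erw [map_gen σ α, freeLift_gen, freeLift_gen]
    rw [op_comp, S.map_comp, ConcreteCategory.comp_apply]
    rfl

lemma freeYoneda_gen {n : ℕ} (S : SimplicialObject AddCommGrpCat.{v}) (x : S.obj (op ⦋n⦌))
    {m : SimplexCategory} (σ : m ⟶ ⦋n⦌) : (freeYoneda S x).app (op m) (gen σ) = S.map σ.op x :=
  freeLift_gen _ _

/-- A morphism out of the alternating face map complex which kills degeneracies factors. -/
lemma PInfty_comp_of_degenerate {X : SimplicialObject AddCommGrpCat.{v}}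
    {D : ChainComplex AddCommGrpCat.{v} ℕ} (ψ : (alternatingFaceMapComplex _).obj X ⟶ D)
    (hψ : ∀ n (i : Fin (n + 1)), X.σ i ≫ ψ.f (n + 1) = 0) : PInfty ≫ ψ = ψ := by
  have hQ : QInfty (X := X) ≫ ψ = 0 := by
    ext n : 1
    rcases n with _ | n
    · simp
    · rw [HomologicalComplex.comp_f, QInfty_f, decomposition_Q, Preadditive.sum_comp]
      refine Finset.sum_eq_zero fun i _ ↦ ?_
      rw [Category.assoc, Category.assoc]
      erw [hψ n i.rev]
      simp
  calc PInfty ≫ ψ = (PInfty + QInfty) ≫ ψ := by rw [Preadditive.add_comp, hQ, add_zero]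
    _ = ψ := by rw [PInfty_add_QInfty, Category.id_comp]

lemma dkCounit_natural {X : SimplicialObject AddCommGrpCat.{v}}
    {D : ChainComplex AddCommGrpCat.{v} ℕ} (θ : X ⟶ Abelian.DoldKan.Γ.obj D) :
    (alternatingFaceMapComplex _).map θ ≫ dkCounit D =
      mooreProj _ ≫ (normalizedMooreComplex _).map θ ≫ (mooreΓIso D).hom := by
  rw [dkCounit, ← Category.assoc, mooreProj_naturality, Category.assoc]

lemma dkCounit_degenerate (D : ChainComplex AddCommGrpCat.{v} ℕ) (n : ℕ) (i : Fin (n + 1)) :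
    (Abelian.DoldKan.Γ.obj D).σ i ≫ (dkCounit D).f (n + 1) = 0 := by
  rw [dkCounit, HomologicalComplex.comp_f, ← Category.assoc]
  erw [σ_comp_mooreProj]
  simp

lemma dkCounit_d (D : ChainComplex AddCommGrpCat.{v} ℕ) (p : ℕ)
    (y : (Abelian.DoldKan.Γ.obj D).obj (op ⦋p + 1⦌)) :
    D.d (p + 1) p ((dkCounit D).f (p + 1) y) = (dkCounit D).f p
      (∑ i : Fin (p + 2), (-1 : ℤ) ^ (i : ℕ) • (Abelian.DoldKan.Γ.obj D).δ i y) := by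
  have h := (dkCounit D).comm (p + 1) p
  rw [alternatingFaceMapComplex_obj_d, AlternatingFaceMapComplex.objD] at h
  exact (ConcreteCategory.congr_hom h y).trans
    (congr_arg ((dkCounit D).f p) (sum_smul_apply _ _ _ _))

lemma dk_injective (D : ChainComplex AddCommGrpCat.{v} ℕ) (n : ℕ)
    (x y : (Abelian.DoldKan.Γ.obj D).obj (op ⦋n⦌))
    (h : ∀ p (σ : ⦋p⦌ ⟶ ⦋n⦌), (dkCounit D).f p ((Abelian.DoldKan.Γ.obj D).map σ.op x) =
      (dkCounit D).f p ((Abelian.DoldKan.Γ.obj D).map σ.op y)) : x = y := by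
  have h1 : (alternatingFaceMapComplex _).map (freeYoneda _ x) ≫ dkCounit D =
      (alternatingFaceMapComplex _).map (freeYoneda _ y) ≫ dkCounit D := by
    ext p : 1
    apply free_hom_ext (m := ⦋p⦌)
    intro σ
    change (dkCounit D).f p ((freeYoneda _ x).app (op ⦋p⦌) (gen σ)) =
      (dkCounit D).f p ((freeYoneda _ y).app (op ⦋p⦌) (gen σ))
    rw [freeYoneda_gen, freeYoneda_gen]
    exact h p σ
  rw [dkCounit_natural, dkCounit_natural] at h1
  have h1 := congr_arg (fun k ↦ mooreIncl _ ≫ k) h1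
  simp only [← Category.assoc, mooreIncl_comp_mooreProj, Category.id_comp] at h1
  rw [cancel_mono] at h1
  have h2 : freeYoneda _ x = freeYoneda _ y :=
    (Abelian.DoldKan.equivalence (A := AddCommGrpCat.{v})).functor.map_injective h1
  have h3 := freeYoneda_gen _ x (𝟙 _)
  rw [h2, freeYoneda_gen] at h3
  simpa using h3.symm

lemma dk_surjective (D : ChainComplex AddCommGrpCat.{v} ℕ) (n : ℕ)
    (φ : ∀ p, (⦋p⦌ ⟶ ⦋n⦌) → D.X p)
    (hφ : ∀ p σ, ¬ Function.Injective σ.toOrderHom → φ p σ = 0)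
    (hd : ∀ p σ, D.d (p + 1) p (φ (p + 1) σ) =
      ∑ i : Fin (p + 2), (-1 : ℤ) ^ (i : ℕ) • φ p (SimplexCategory.δ i ≫ σ)) :
    ∃ x : (Abelian.DoldKan.Γ.obj D).obj (op ⦋n⦌), ∀ p (σ : ⦋p⦌ ⟶ ⦋n⦌),
      (dkCounit D).f p ((Abelian.DoldKan.Γ.obj D).map σ.op x) = φ p σ := by
  let ψ : (alternatingFaceMapComplex _).obj (freeSimplex.{v} n) ⟶ D :=
    { f := fun p ↦ freeLift (m := ⦋p⦌) (φ p)
      comm' := by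
        rintro _ p rfl
        apply free_hom_ext (m := ⦋p + 1⦌)
        intro σ
        rw [ConcreteCategory.comp_apply, ConcreteCategory.comp_apply]
        rw [alternatingFaceMapComplex_obj_d, AlternatingFaceMapComplex.objD]
        erw [freeLift_gen, hd]
        have h1 : (∑ i : Fin (p + 2), (-1 : ℤ) ^ (i : ℕ) • (freeSimplex.{v} n).δ i) (gen σ) =
            ∑ i : Fin (p + 2), (-1 : ℤ) ^ (i : ℕ) • gen (SimplexCategory.δ i ≫ σ) := by
          rw [sum_smul_apply]
          exact Finset.sum_congr rfl fun i _ ↦ by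
            exact congr_arg _ (map_gen σ (SimplexCategory.δ i))
        refine Eq.trans ?_ (congr_arg (freeLift (m := ⦋p⦌) (φ p)) h1).symm
        rw [map_sum]
        refine Finset.sum_congr rfl fun i _ ↦ ?_
        rw [map_zsmul, freeLift_gen] }
  have hψ : PInfty ≫ ψ = ψ := by
    apply PInfty_comp_of_degenerate
    intro p i
    apply free_hom_ext (m := ⦋p⦌)
    intro σ
    rw [ConcreteCategory.comp_apply]
    refine (congr_arg _ (map_gen σ (SimplexCategory.σ i))).trans ?_
    refine (freeLift_gen (φ (p + 1)) _).trans ?_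
    refine (hφ _ _ ?_).trans rfl
    intro hinj
    have := @hinj i.castSucc i.succ (by
      rw [SimplexCategory.comp_toOrderHom]
      simp [SimplexCategory.σ])
    simp [Fin.ext_iff] at this
  obtain ⟨θ, hθ⟩ := (Abelian.DoldKan.equivalence (A := AddCommGrpCat.{v})).functor.map_surjective
    (X := freeSimplex.{v} n) (Y := Abelian.DoldKan.Γ.obj D)
    ((mooreIncl _ ≫ ψ) ≫ (mooreΓIso D).inv)
  have hθ' : (alternatingFaceMapComplex _).map θ ≫ dkCounit D = ψ := by
    rw [dkCounit_natural]
    have : (normalizedMooreComplex _).map θ = (mooreIncl _ ≫ ψ) ≫ (mooreΓIso D).inv := hθ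
    rw [this, Category.assoc, Iso.inv_hom_id, Category.comp_id, ← Category.assoc,
      mooreProj_comp_mooreIncl, hψ]
  refine ⟨θ.app (op ⦋n⦌) (gen (𝟙 _)), fun p σ ↦ ?_⟩
  have h1 : (Abelian.DoldKan.Γ.obj D).map σ.op (θ.app (op ⦋n⦌) (gen (𝟙 _))) =
      θ.app (op ⦋p⦌) (gen σ) := by
    rw [← ConcreteCategory.comp_apply, ← θ.naturality, ConcreteCategory.comp_apply, map_gen,
      Category.comp_id]
  rw [h1]
  have h2 : ((alternatingFaceMapComplex _).map θ ≫ dkCounit D).f p = ψ.f p := by rw [hθ']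
  exact (ConcreteCategory.congr_hom h2 (gen (m := ⦋p⦌) σ)).trans (freeLift_gen (φ p) σ)


/-- The simplicial set attached to a chain complex `C` of abelian groups: truncate `C`, apply the
Dold-Kan correspondence to obtain a simplicial abelian group, and forget the group structure. -/
noncomputable def mappingSpace (C : ChainComplex AddCommGrpCat.{v} ℤ) : SSet.{v} :=
  ((SimplicialObject.whiskering _ _).obj (forget AddCommGrpCat.{v})).obj
    (Abelian.DoldKan.Γ.obj (trunc C))

/-- The chain map from the normalized chains of the standard `n`-simplex to `C` which corresponds
to an `n`-simplex of `mappingSpace C` under the Dold-Kan correspondence. -/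
noncomputable def toNCochain (C : ChainComplex AddCommGrpCat.{v} ℤ) (n : ℕ)
    (x : (Abelian.DoldKan.Γ.obj (trunc C)).obj (op ⦋n⦌)) : NCochain C n where
  val p σ := truncι C p ((dkCounit (trunc C)).f p ((Abelian.DoldKan.Γ.obj (trunc C)).map σ.op x))
  degenerate p σ hσ := by
    rcases p with _ | p
    · exact (hσ (fun _ _ _ ↦ Subsingleton.elim (α := Fin 1) _ _)).elim
    · obtain ⟨i, θ, rfl⟩ := SimplexCategory.eq_σ_comp_of_not_injective σ hσ
      rw [op_comp, Functor.map_comp, ConcreteCategory.comp_apply]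
      have h := ConcreteCategory.congr_hom (dkCounit_degenerate (trunc C) p i)
        ((Abelian.DoldKan.Γ.obj (trunc C)).map θ.op x)
      exact (congr_arg (truncι C (p + 1)) h).trans (map_zero (truncι C (p + 1)).hom)
  d_zero σ := d_truncι_zero C _
  d_succ p σ := by
    rw [d_truncι, dkCounit_d]
    rw [map_sum, map_sum]
    refine Finset.sum_congr rfl fun i _ ↦ ?_
    rw [map_zsmul, map_zsmul, op_comp, Functor.map_comp, ConcreteCategory.comp_apply]
    rfl

lemma toNCochain_bijective (C : ChainComplex AddCommGrpCat.{v} ℤ) (n : ℕ) :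
    Function.Bijective (toNCochain C n) := by
  constructor
  · intro x y h
    apply dk_injective
    intro p σ
    exact truncι_injective C p (congr_fun (congr_fun (congr_arg NCochain.val h) p) σ)
  · intro f
    have h1 : ∀ p (σ : ⦋p⦌ ⟶ ⦋n⦌), ∃ y : (trunc C).X p, truncι C p y = f.val p σ := by
      intro p σ
      rcases p with _ | p
      · exact range_truncι_zero C _ (f.d_zero σ)
      · exact truncι_succ_surjective C p _
    choose φ hφ using h1
    obtain ⟨x, hx⟩ := dk_surjective (trunc C) n φ
      (fun p σ h ↦ truncι_injective C p (by rw [hφ, f.degenerate p σ h, map_zero]))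
      (fun p σ ↦ truncι_injective C p (by
        rw [← d_truncι, hφ, f.d_succ, map_sum]
        refine Finset.sum_congr rfl fun i _ ↦ ?_
        rw [map_zsmul, hφ]))
    refine ⟨x, NCochain.ext fun p σ ↦ ?_⟩
    change truncι C p _ = _
    rw [hx, hφ]

lemma toNCochain_map (C : ChainComplex AddCommGrpCat.{v} ℤ) {n m : ℕ} (α : ⦋m⦌ ⟶ ⦋n⦌)
    (x : (Abelian.DoldKan.Γ.obj (trunc C)).obj (op ⦋n⦌)) :
    toNCochain C m ((Abelian.DoldKan.Γ.obj (trunc C)).map α.op x) = (toNCochain C n x).map α := by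
  ext p σ
  change truncι C p ((dkCounit (trunc C)).f p ((Abelian.DoldKan.Γ.obj (trunc C)).map σ.op
    ((Abelian.DoldKan.Γ.obj (trunc C)).map α.op x))) = truncι C p ((dkCounit (trunc C)).f p
      ((Abelian.DoldKan.Γ.obj (trunc C)).map (σ ≫ α).op x))
  rw [op_comp, Functor.map_comp, ConcreteCategory.comp_apply]

/-- The `n`-simplices of `mappingSpace C` are the chain maps from the normalized chains of the
standard `n`-simplex to `C`. -/
noncomputable def simplexEquiv (C : ChainComplex AddCommGrpCat.{v} ℤ) (Δ : SimplexCategoryᵒᵖ) :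
    (mappingSpace C).obj Δ ≃ NCochain C Δ.unop.len :=
  Equiv.ofBijective (toNCochain C Δ.unop.len) (toNCochain_bijective C Δ.unop.len)

lemma simplexEquiv_map (C : ChainComplex AddCommGrpCat.{v} ℤ) {Δ Δ' : SimplexCategoryᵒᵖ}
    (α : Δ ⟶ Δ') (x : (mappingSpace C).obj Δ) :
    simplexEquiv C Δ' ((mappingSpace C).map α x) = (simplexEquiv C Δ x).map α.unop :=
  toNCochain_map C (n := Δ.unop.len) (m := Δ'.unop.len) α.unop x

lemma simplexEquiv_symm_map (C : ChainComplex AddCommGrpCat.{v} ℤ) {Δ Δ' : SimplexCategoryᵒᵖ}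
    (α : Δ ⟶ Δ') (f : NCochain C Δ.unop.len) :
    (simplexEquiv C Δ').symm (f.map α.unop) =
      (mappingSpace C).map α ((simplexEquiv C Δ).symm f) := by
  rw [Equiv.symm_apply_eq, simplexEquiv_map, Equiv.apply_symm_apply]

open MonoidalCategory

variable (A) in
/-- A DG-category as a simplicial category: the same objects, the mapping spaces
`mappingSpace (Hom X Y)`, and the composition induced by the composition of the DG-category
through the Alexander-Whitney map. -/
noncomputable instance simplicialEnrichment : EnrichedCategory SSet.{v} A where
  Hom X Y := mappingSpace (Hom X Y)
  id X :=
    { app := fun Δ ↦ ↾fun _ ↦ (simplexEquiv _ Δ).symm (one X Δ.unop.len)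
      naturality := fun Δ Δ' α ↦ by
        ext x
        refine Eq.trans ?_ (simplexEquiv_symm_map _ α _)
        rw [one_map]; rfl }
  comp X Y Z :=
    { app := fun Δ ↦ ↾fun x ↦ (simplexEquiv _ Δ).symm
        (cup (simplexEquiv _ Δ x.2) (simplexEquiv _ Δ x.1))
      naturality := fun Δ Δ' α ↦ by
        ext x
        refine Eq.trans ?_ (simplexEquiv_symm_map _ α _)
        rw [cup_map, ← simplexEquiv_map, ← simplexEquiv_map]; rfl }
  id_comp X Y := by
    ext Δ x
    change (simplexEquiv _ Δ).symm (cup (simplexEquiv _ Δ x)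
      (simplexEquiv _ Δ ((simplexEquiv _ Δ).symm (one X Δ.unop.len)))) = x
    rw [Equiv.apply_symm_apply, cup_one, Equiv.symm_apply_apply]
  comp_id X Y := by
    ext Δ x
    change (simplexEquiv _ Δ).symm (cup (simplexEquiv _ Δ ((simplexEquiv _ Δ).symm
      (one Y Δ.unop.len))) (simplexEquiv _ Δ x)) = x
    rw [Equiv.apply_symm_apply, one_cup, Equiv.symm_apply_apply]
  assoc W X Y Z := by
    ext Δ x
    obtain ⟨f, g, h⟩ := x
    change (simplexEquiv _ Δ).symm (cup (simplexEquiv _ Δ h) (simplexEquiv _ Δ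
        ((simplexEquiv _ Δ).symm (cup (simplexEquiv _ Δ g) (simplexEquiv _ Δ f))))) =
      (simplexEquiv _ Δ).symm (cup (simplexEquiv _ Δ ((simplexEquiv _ Δ).symm
        (cup (simplexEquiv _ Δ h) (simplexEquiv _ Δ g)))) (simplexEquiv _ Δ f))
    rw [Equiv.apply_symm_apply, Equiv.apply_symm_apply, cup_assoc]

variable (A) in
/-- The homotopy coherent nerve of a DG-category, viewed as a simplicial category. -/
noncomputable def coherentNerve : SSet.{max u v} :=
  SimplicialNerve (ForgetEnrichment SSet.{v} A)

end DGCategory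

/-! The only property of the mapping spaces that matters is that they are simplicial abelian groups,
through the operation `x + y - z`. No compatibility of this operation with composition is needed.

Filling an inner horn of dimension `n` with missing face `i` means extending to the simplicial
thickening of `{0, …, n}` an enriched functor known on the faces `j ≠ i`. A simplex of the mapping
space from `k` to `m` is a chain of paths, that is, of subsets of `{k, …, m}` containing `k` and
`m`. If `k > 0` or `m < n`, all paths avoid `0` or avoid `n`, and since `i` is inner the
corresponding face of the horn already gives the value. Only the cube of paths from `0` to `n`
remains. Values are prescribed there on its face of paths through `l`, for each inner `l` (by
composition, `split`), and on its face of paths avoiding `j`, for each inner `j ≠ i` (by the horn,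
`val`). This is every face of the cube but one.

The extension is built one face at a time. Let `ρ` be an endomorphism of the cube that fixes a face
pointwise, let `f` be the prescription there and `F` the current map. Then `F(T) + f(ρT) - F(ρT)`
equals `f` on the face, and is still `F(T)` wherever `F` and `f` agree at `ρT` (`exists_glue`). So
`ρ` must carry each face already treated to a place where agreement is known. For the face through
`l`, `ρ` adds `l` (`exists_split`). For the face avoiding `j`, deleting `j` would fail on the paths
through `j`; instead `ρ` replaces `j` by `i`, which sends those paths into the face through `i`.
This preserves avoidance of every point except `i`, and avoidance of `i` is exactly the face that is
not prescribed (`exists_extremal`). -/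

open MonoidalCategory SimplicialCategory EnrichedCategory Opposite

/-! ### Mal'cev operations and gluing -/

/-- A Mal'cev operation on a simplicial set, natural in the simplicial degree. -/
structure SSet.MalcevOperation (S : SSet.{v}) where
  op {Δ : SimplexCategoryᵒᵖ} : S.obj Δ → S.obj Δ → S.obj Δ → S.obj Δ
  map_op {Δ Δ' : SimplexCategoryᵒᵖ} (θ : Δ ⟶ Δ') (x y z : S.obj Δ) :
    S.map θ (op x y z) = op (S.map θ x) (S.map θ y) (S.map θ z)
  op_right {Δ : SimplexCategoryᵒᵖ} (x y : S.obj Δ) : op x y y = x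
  op_outer {Δ : SimplexCategoryᵒᵖ} (x y : S.obj Δ) : op x y x = y

/-- A map `F` can be modified to agree with `f` on the fixed points of `ρ`, without changing it
on the simplices whose image under `ρ` is a point of agreement of `F` and `f`. -/
lemma SSet.MalcevOperation.exists_glue {K S : SSet.{v}} (μ : S.MalcevOperation)
    (F f : K ⟶ S) (ρ : K ⟶ K) : ∃ F' : K ⟶ S,
      (∀ Δ (T : K.obj Δ), F.app Δ (ρ.app Δ T) = f.app Δ (ρ.app Δ T) →
        F'.app Δ T = F.app Δ T) ∧
      (∀ Δ (T : K.obj Δ), ρ.app Δ T = T → F'.app Δ T = f.app Δ T) := by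
  -- For `op x y z = x + y - z` this is `F(T) + f(ρT) - F(ρT)`.
  refine ⟨{ app := fun Δ ↦ ↾fun T ↦ μ.op (F.app Δ T) (f.app Δ (ρ.app Δ T)) (F.app Δ (ρ.app Δ T))
            naturality := fun Δ Δ' θ ↦ ?_ }, fun Δ T h ↦ ?_, fun Δ T h ↦ ?_⟩
  · ext T
    simp [μ.map_op, NatTrans.naturality_apply]
  · change μ.op _ _ _ = _
    rw [h, μ.op_right]
  · change μ.op _ _ _ = _
    rw [h, μ.op_outer]

/-! ### Simplices of the mapping spaces of the thickening as chains of paths -/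

namespace CategoryTheory.SimplicialThickening

variable {J : Type v} [LinearOrder J] {Δ : SimplexCategoryᵒᵖ}

/-- The subset of `J` underlying a vertex of a simplex of a mapping space. -/
def support {k m : SimplicialThickening J} (T : (sHom k m).obj Δ) (p : Fin (Δ.unop.len + 1)) :
    Set J :=
  Path.I (Functor.obj (C := Fin (Δ.unop.len + 1)) (D := k ⟶ m) T p)

/-- The composition of simplices in a simplicial category. -/
def compSimplex {C : Type u} [Category.{v} C] [SimplicialCategory C] {X Y Z : C}
    (f : (sHom X Y).obj Δ) (g : (sHom Y Z).obj Δ) : (sHom X Z).obj Δ :=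
  (eComp SSet X Y Z).app Δ (show (sHom X Y ⊗ sHom Y Z).obj Δ from (f, g))

section

variable {k l m : SimplicialThickening J}

instance (P Q : k ⟶ m) : Subsingleton (P ⟶ Q) :=
  ⟨fun _ _ ↦ InducedCategory.hom_ext (Subsingleton.elim _ _)⟩

/-- The mapping space is the nerve of a poset, so a simplex is determined by its vertices.
Identities between simplices thereby become identities between sets. -/
lemma simplex_ext {T T' : (sHom k m).obj Δ} (h : ∀ p, support T p = support T' p) : T = T' := by
  have key (F F' : Fin (Δ.unop.len + 1) ⥤ (k ⟶ m)) (h : ∀ p, (F.obj p).I = (F'.obj p).I) :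
      F = F' :=
    Functor.ext (fun p ↦ Path.ext (h p)) (fun _ _ _ ↦ Subsingleton.elim _ _)
  exact key T T' h

lemma support_compSimplex (T : (sHom k l).obj Δ) (S : (sHom l m).obj Δ) (p) :
    support (compSimplex T S) p = support T p ∪ support S p := rfl

lemma support_eId (x : (𝟙_ SSet).obj Δ) (p) :
    support ((eId SSet k).app Δ x) p = {k.as} := rfl

lemma left_mem_support (T : (sHom k m).obj Δ) (p) : k.as ∈ support T p := Path.left _

lemma right_mem_support (T : (sHom k m).obj Δ) (p) : m.as ∈ support T p := Path.right _

lemma le_of_mem_support (T : (sHom k m).obj Δ) (p) {x : J} (h : x ∈ support T p) : k.as ≤ x :=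
  Path.left_le _ _ h

lemma le_of_mem_support' (T : (sHom k m).obj Δ) (p) {x : J} (h : x ∈ support T p) : x ≤ m.as :=
  Path.le_right _ _ h

lemma support_functor_map {J' : Type v} [LinearOrder J'] (β : J →o J') (T : (sHom k m).obj Δ) (p) :
    support (((functor β).map k m).app Δ T) p = β '' support T p := rfl

/-- The map of mapping spaces induced by a monotone operation on subsets. -/
def pathMap {k' m' : SimplicialThickening J} (φ : Set J → Set J) (hφ : Monotone φ)
    (h : ∀ P : k ⟶ m, k'.as ∈ φ P.I ∧ m'.as ∈ φ P.I ∧ φ P.I ⊆ Set.Icc k'.as m'.as) :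
    sHom k m ⟶ sHom k' m' :=
  nerveMap (C := k ⟶ m) (D := k' ⟶ m')
    { obj P := ⟨φ P.I, (h P).1, (h P).2.1, fun _ hx ↦ ((h P).2.2 hx).1, fun _ hx ↦ ((h P).2.2 hx).2⟩
      map f := ⟨⟨⟨hφ f.1.1.1⟩⟩⟩ }

end

/-! ### Enriched functors evaluated on simplices -/

section

variable {Δ : SimplexCategoryᵒᵖ} {C : Type u} [Category.{v} C] [SimplicialCategory C]

lemma compSimplex_assoc {W X Y Z : C} (f : (sHom W X).obj Δ) (g : (sHom X Y).obj Δ)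
    (h : (sHom Y Z).obj Δ) :
    compSimplex (compSimplex f g) h = compSimplex f (compSimplex g h) :=
  (ConcreteCategory.congr_hom (NatTrans.congr_app (e_assoc SSet W X Y Z) Δ)
    (show (sHom W X ⊗ sHom X Y ⊗ sHom Y Z).obj Δ from (f, g, h)) :)

lemma eId_compSimplex {X Y : C} (x : (𝟙_ SSet.{v}).obj Δ) (f : (sHom X Y).obj Δ) :
    compSimplex ((eId SSet X).app Δ x) f = f :=
  (ConcreteCategory.congr_hom (NatTrans.congr_app (e_id_comp SSet X Y) Δ) f :)

lemma compSimplex_eId {X Y : C} (x : (𝟙_ SSet.{v}).obj Δ) (f : (sHom X Y).obj Δ) :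
    compSimplex f ((eId SSet Y).app Δ x) = f :=
  (ConcreteCategory.congr_hom (NatTrans.congr_app (e_comp_id SSet X Y) Δ) f :)

variable {J : Type v} [LinearOrder J]

/-- The action of an enriched functor on mapping spaces, with prescribed values on objects. -/
def mapTo (G : EnrichedFunctor SSet (SimplicialThickening J) C) {k m : SimplicialThickening J}
    {X Y : C} (hX : G.obj k = X) (hY : G.obj m = Y) : sHom k m ⟶ sHom X Y :=
  G.map k m ≫ eqToHom (by rw [hX, hY])

variable (G G' : EnrichedFunctor SSet (SimplicialThickening J) C)
  {k l m k' m' : SimplicialThickening J} {X Y Z : C}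

lemma mapTo_rfl : mapTo G (k := k) (m := m) rfl rfl = G.map k m := Category.comp_id _

lemma mapTo_compSimplex (hX : G.obj k = X) (hY : G.obj l = Y) (hZ : G.obj m = Z)
    (T : (sHom k l).obj Δ) (S : (sHom l m).obj Δ) :
    (mapTo G hX hZ).app Δ (compSimplex T S) =
      compSimplex ((mapTo G hX hY).app Δ T) ((mapTo G hY hZ).app Δ S) := by
  subst hX hY hZ
  simp only [mapTo_rfl]
  exact (ConcreteCategory.congr_hom (NatTrans.congr_app (G.map_comp k l m) Δ)
    (show (sHom k l ⊗ sHom l m).obj Δ from (T, S)) :)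

lemma mapTo_eId (hX : G.obj k = X) (x : (𝟙_ SSet.{v}).obj Δ) :
    (mapTo G hX hX).app Δ ((eId SSet k).app Δ x) = (eId SSet X).app Δ x := by
  subst hX
  simp only [mapTo_rfl]
  exact (ConcreteCategory.congr_hom (NatTrans.congr_app (G.map_id k) Δ) x :)

/-- Absorbs the transports that arise when endpoints or functors are equal only propositionally, for
instance endpoints fixed by a retraction of the ordinal. -/
lemma mapTo_eq_of_support_eq (hk : k = k') (hm : m = m') (hG : G = G')
    (hX : G.obj k = X) (hY : G.obj m = Y) (hX' : G'.obj k' = X) (hY' : G'.obj m' = Y)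
    (T : (sHom k m).obj Δ) (T' : (sHom k' m').obj Δ) (h : ∀ p, support T p = support T' p) :
    (mapTo G hX hY).app Δ T = (mapTo G' hX' hY').app Δ T' := by
  subst hk hm hG
  rw [simplex_ext h]

variable {G G'} in
-- Comparing both object functions with a third one, `o`, puts the two actions on mapping spaces in
-- the same type.
lemma ext_of_mapTo {o : SimplicialThickening J → C} (h : ∀ k, G.obj k = o k)
    (h' : ∀ k, G'.obj k = o k)
    (H : ∀ k m (Δ : SimplexCategoryᵒᵖ) (T : (sHom k m).obj Δ),
      (mapTo G (h k) (h m)).app Δ T = (mapTo G' (h' k) (h' m)).app Δ T) : G = G' := by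
  obtain ⟨obj, map, _, _⟩ := G
  obtain ⟨obj', map', _, _⟩ := G'
  obtain rfl : obj = o := funext h
  obtain rfl : obj' = obj := funext h'
  simp only [mapTo_rfl] at H
  congr 1
  funext k m
  ext Δ T
  exact H k m Δ T

lemma mapTo_comp_functor {J' : Type v} [LinearOrder J'] (β : J' →o J)
    {k m : SimplicialThickening J'}
    (hX : G.obj ((functor β).obj k) = X) (hY : G.obj ((functor β).obj m) = Y)
    (T : (sHom k m).obj Δ) :
    (mapTo ((functor β).comp SSet G) hX hY).app Δ T =
      (mapTo G hX hY).app Δ (((functor β).map k m).app Δ T) := by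
  subst hX hY
  simp only [mapTo_rfl]
  rfl

end

/-! ### Faces of the cube of paths, and operations on paths -/

section

variable {J : Type v} [LinearOrder J] {Δ : SimplexCategoryᵒᵖ} {k l m : SimplicialThickening J}

/-- All the vertices of the simplex contain `x`. -/
def Contains (T : (sHom k m).obj Δ) (x : J) : Prop := ∀ p, x ∈ support T p

/-- No vertex of the simplex contains `x`. -/
def Avoids (T : (sHom k m).obj Δ) (x : J) : Prop := ∀ p, x ∉ support T p

/-- The part of a path below `l`. -/
def lower (h : k.as ≤ l.as) : sHom k m ⟶ sHom k l :=
  pathMap (fun S ↦ S ∩ Set.Iic l.as ∪ {l.as}) (fun S S' h ↦ by dsimp; gcongr) (fun P ↦ by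
    refine ⟨Or.inl ⟨P.left, h⟩, Or.inr rfl, ?_⟩
    rintro x (hx | rfl)
    exacts [⟨P.left_le _ hx.1, hx.2⟩, ⟨h, le_rfl⟩])

/-- The part of a path above `l`. -/
def upper (h : l.as ≤ m.as) : sHom k m ⟶ sHom l m :=
  pathMap (fun S ↦ S ∩ Set.Ici l.as ∪ {l.as}) (fun S S' h ↦ by dsimp; gcongr) (fun P ↦ by
    refine ⟨Or.inr rfl, Or.inl ⟨P.right, h⟩, ?_⟩
    rintro x (hx | rfl)
    exacts [⟨hx.2, P.le_right _ hx.1⟩, ⟨le_rfl, h⟩])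

/-- Adding a point to the paths. -/
def addPoint (h : k.as ≤ l.as) (h' : l.as ≤ m.as) : sHom k m ⟶ sHom k m :=
  pathMap (fun S ↦ S ∪ {l.as}) (fun S S' h ↦ by dsimp; gcongr) (fun P ↦ by
    refine ⟨Or.inl P.left, Or.inl P.right, ?_⟩
    rintro x (hx | rfl)
    exacts [⟨P.left_le _ hx, P.le_right _ hx⟩, ⟨h, h'⟩])

/-- Replacing the point `j` by the point `l` in the paths which contain `j`. -/
def movePoint (j : J) (hk : k.as ≠ j) (hm : m.as ≠ j) (h : k.as ≤ l.as) (h' : l.as ≤ m.as) :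
    sHom k m ⟶ sHom k m :=
  pathMap (fun S ↦ S \ {j} ∪ {x | x = l.as ∧ j ∈ S})
    (fun S S' h ↦ by
      rintro x (hx | hx)
      exacts [Or.inl ⟨h hx.1, hx.2⟩, Or.inr ⟨hx.1, h hx.2⟩]) (fun P ↦ by
    refine ⟨Or.inl ⟨P.left, hk⟩, Or.inl ⟨P.right, hm⟩, ?_⟩
    rintro x (hx | ⟨rfl, -⟩)
    exacts [⟨P.left_le _ hx.1, P.le_right _ hx.1⟩, ⟨h, h'⟩])

lemma support_lower (h : k.as ≤ l.as) (T : (sHom k m).obj Δ) (p) :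
    support ((lower h).app Δ T) p = support T p ∩ Set.Iic l.as ∪ {l.as} := rfl

lemma support_upper (h : l.as ≤ m.as) (T : (sHom k m).obj Δ) (p) :
    support ((upper h).app Δ T) p = support T p ∩ Set.Ici l.as ∪ {l.as} := rfl

lemma support_addPoint (h : k.as ≤ l.as) (h' : l.as ≤ m.as) (T : (sHom k m).obj Δ) (p) :
    support ((addPoint h h').app Δ T) p = support T p ∪ {l.as} := rfl

lemma support_movePoint (j : J) (hk : k.as ≠ j) (hm : m.as ≠ j) (h : k.as ≤ l.as)
    (h' : l.as ≤ m.as) (T : (sHom k m).obj Δ) (p) :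
    support ((movePoint j hk hm h h').app Δ T) p =
      support T p \ {j} ∪ {x | x = l.as ∧ j ∈ support T p} := rfl

/-- A path through `l` is the union of its parts below and above `l`. With the next two lemmas, this
identifies the face through `l` with a product of two mapping spaces. -/
lemma compSimplex_lower_upper (h : k.as ≤ l.as) (h' : l.as ≤ m.as) {T : (sHom k m).obj Δ}
    (hT : Contains T l.as) :
    compSimplex ((lower h).app Δ T) ((upper h').app Δ T) = T := by
  refine simplex_ext fun p ↦ ?_
  have := hT p
  rw [support_compSimplex, support_lower, support_upper]
  ext x
  have := le_total x l.as
  simp only [Set.mem_union, Set.mem_inter_iff, Set.mem_Iic, Set.mem_Ici, Set.mem_singleton_iff]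
  grind

lemma lower_compSimplex (h : k.as ≤ l.as) (T : (sHom k l).obj Δ) (S : (sHom l m).obj Δ) :
    (lower h).app Δ (compSimplex T S) = T := by
  refine simplex_ext fun p ↦ ?_
  rw [support_lower, support_compSimplex]
  ext x
  have := right_mem_support T p
  have := @le_of_mem_support _ _ _ _ _ S p x
  have := @le_of_mem_support' _ _ _ _ _ T p x
  simp only [Set.mem_union, Set.mem_inter_iff, Set.mem_Iic, Set.mem_singleton_iff]
  grind

lemma upper_compSimplex (h : l.as ≤ m.as) (T : (sHom k l).obj Δ) (S : (sHom l m).obj Δ) :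
    (upper h).app Δ (compSimplex T S) = S := by
  refine simplex_ext fun p ↦ ?_
  rw [support_upper, support_compSimplex]
  ext x
  have := left_mem_support S p
  have := @le_of_mem_support _ _ _ _ _ S p x
  have := @le_of_mem_support' _ _ _ _ _ T p x
  simp only [Set.mem_union, Set.mem_inter_iff, Set.mem_Ici, Set.mem_singleton_iff]
  grind

lemma lower_lower {l' : SimplicialThickening J} (h : k.as ≤ l.as) (h' : k.as ≤ l'.as)
    (hl : l.as ≤ l'.as) (T : (sHom k m).obj Δ) :
    (lower h).app Δ ((lower (l := l') h').app Δ T) = (lower h).app Δ T := by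
  refine simplex_ext fun p ↦ ?_
  rw [support_lower, support_lower, support_lower]
  ext x
  simp only [Set.mem_union, Set.mem_inter_iff, Set.mem_Iic, Set.mem_singleton_iff]
  grind

lemma upper_upper {l' : SimplicialThickening J} (h : l.as ≤ m.as) (h' : l'.as ≤ m.as)
    (hl : l'.as ≤ l.as) (T : (sHom k m).obj Δ) :
    (upper h).app Δ ((upper (l := l') h').app Δ T) = (upper h).app Δ T := by
  refine simplex_ext fun p ↦ ?_
  rw [support_upper, support_upper, support_upper]
  ext x
  simp only [Set.mem_union, Set.mem_inter_iff, Set.mem_Ici, Set.mem_singleton_iff]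
  grind

/-- Both sides are the middle piece of the path, between `l` and `l'`; this serves to compare
cutting at `l` with cutting at `l'`. -/
lemma upper_lower {l' : SimplicialThickening J} (h : l.as ≤ l'.as) (h₁ : l.as ≤ m.as)
    (h₂ : k.as ≤ l'.as) (T : (sHom k m).obj Δ) :
    (upper h).app Δ ((lower (l := l') h₂).app Δ T) =
      (lower h).app Δ ((upper h₁).app Δ T) := by
  refine simplex_ext fun p ↦ ?_
  rw [support_upper, support_lower, support_lower, support_upper]
  ext x
  simp only [Set.mem_union, Set.mem_inter_iff, Set.mem_Ici, Set.mem_Iic, Set.mem_singleton_iff]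
  grind

lemma Contains.lower {x : J} {T : (sHom k m).obj Δ} (hT : Contains T x) (h : k.as ≤ l.as)
    (hx : x ≤ l.as) : Contains ((lower h).app Δ T) x :=
  fun p ↦ Or.inl ⟨hT p, hx⟩

lemma Contains.upper {x : J} {T : (sHom k m).obj Δ} (hT : Contains T x) (h : l.as ≤ m.as)
    (hx : l.as ≤ x) : Contains ((upper h).app Δ T) x :=
  fun p ↦ Or.inl ⟨hT p, hx⟩

lemma Avoids.lower {x : J} {T : (sHom k m).obj Δ} (hT : Avoids T x) (h : k.as ≤ l.as)
    (hx : l.as ≠ x) : Avoids ((lower h).app Δ T) x := by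
  rintro p (h | h)
  exacts [hT p h.1, hx h.symm]

lemma Avoids.upper {x : J} {T : (sHom k m).obj Δ} (hT : Avoids T x) (h : l.as ≤ m.as)
    (hx : l.as ≠ x) : Avoids ((upper h).app Δ T) x := by
  rintro p (h | h)
  exacts [hT p h.1, hx h.symm]

lemma avoids_of_lt (T : (sHom k m).obj Δ) {x : J} (h : x < k.as) : Avoids T x :=
  fun p hp ↦ (le_of_mem_support T p hp).not_gt h

lemma avoids_of_gt (T : (sHom k m).obj Δ) {x : J} (h : m.as < x) : Avoids T x :=
  fun p hp ↦ (le_of_mem_support' T p hp).not_gt h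

lemma addPoint_of_contains (h : k.as ≤ l.as) (h' : l.as ≤ m.as) {T : (sHom k m).obj Δ}
    (hT : Contains T l.as) : (addPoint h h').app Δ T = T := by
  refine simplex_ext fun p ↦ ?_
  rw [support_addPoint, Set.union_eq_self_of_subset_right (by simpa using hT p)]

lemma Contains.addPoint {x : J} {T : (sHom k m).obj Δ} (hT : Contains T x) (h : k.as ≤ l.as)
    (h' : l.as ≤ m.as) : Contains ((addPoint h h').app Δ T) x :=
  fun p ↦ Or.inl (hT p)

lemma contains_addPoint (h : k.as ≤ l.as) (h' : l.as ≤ m.as) (T : (sHom k m).obj Δ) :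
    Contains ((addPoint h h').app Δ T) l.as :=
  fun _ ↦ Or.inr rfl

section

variable {j : J} (hk : k.as ≠ j) (hm : m.as ≠ j) (h : k.as ≤ l.as) (h' : l.as ≤ m.as)

lemma movePoint_of_avoids {T : (sHom k m).obj Δ} (hT : Avoids T j) :
    (movePoint j hk hm h h').app Δ T = T := by
  refine simplex_ext fun p ↦ ?_
  have := hT p
  rw [support_movePoint]
  ext x
  simp only [Set.mem_union, Set.mem_sdiff, Set.mem_singleton_iff, Set.mem_ofPred_eq]
  grind

lemma avoids_movePoint (hl : l.as ≠ j) (T : (sHom k m).obj Δ) :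
    Avoids ((movePoint j hk hm h h').app Δ T) j := by
  rintro p (hp | hp)
  exacts [hp.2 rfl, hl hp.1.symm]

lemma Contains.movePoint {x : J} (hx : x ≠ j) {T : (sHom k m).obj Δ} (hT : Contains T x) :
    Contains ((movePoint j hk hm h h').app Δ T) x :=
  fun p ↦ Or.inl ⟨hT p, hx⟩

/-- This is why `j` is moved and not deleted: paths through `j` land in the face through `l`, where
values will already be known. -/
lemma Contains.movePoint_self {T : (sHom k m).obj Δ} (hT : Contains T j) :
    Contains ((SimplicialThickening.movePoint j hk hm h h').app Δ T) l.as :=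
  fun p ↦ Or.inr ⟨rfl, hT p⟩

lemma Avoids.movePoint {x : J} (hx : l.as ≠ x) {T : (sHom k m).obj Δ} (hT : Avoids T x) :
    Avoids ((movePoint j hk hm h h').app Δ T) x := by
  rintro p (hp | hp)
  exacts [hT p hp.1, hx hp.1.symm]

end

end

/-! ### Compatible families and the values they prescribe -/

/-- Enriched functors indexed by the points `j ≠ i`, which agree on the paths where they are
meaningful: the functor with index `j` is only used on paths which avoid `j`. -/
structure CompatibleFamily {J : Type v} [LinearOrder J] (i : J)
    (C : Type u) [Category.{v} C] [SimplicialCategory C] where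
  obj : SimplicialThickening J → C
  functor (j : J) (hj : j ≠ i) : EnrichedFunctor SSet.{v} (SimplicialThickening J) C
  functor_obj (j : J) (hj : j ≠ i) (k : SimplicialThickening J) (hk : k.as ≠ j) :
    (functor j hj).obj k = obj k
  agree (j l : J) (hj : j ≠ i) (hl : l ≠ i) (k m : SimplicialThickening J)
    (hkj : k.as ≠ j) (hmj : m.as ≠ j) (hkl : k.as ≠ l) (hml : m.as ≠ l)
    (Δ : SimplexCategoryᵒᵖ) (T : (sHom k m).obj Δ) (_ : Avoids T j) (_ : Avoids T l) :
    (mapTo (functor j hj) (functor_obj j hj k hkj) (functor_obj j hj m hmj)).app Δ T =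
      (mapTo (functor l hl) (functor_obj l hl k hkl) (functor_obj l hl m hml)).app Δ T

namespace CompatibleFamily

variable {J : Type v} [LinearOrder J] {i : J}
  {C : Type u} [Category.{v} C] [SimplicialCategory C] (D : CompatibleFamily i C)
  {Δ : SimplexCategoryᵒᵖ} {k l m : SimplicialThickening J}

/-- The map on mapping spaces given by the functor with index `j`. -/
def val {j : J} (hj : j ≠ i) (hk : k.as ≠ j) (hm : m.as ≠ j) :
    sHom k m ⟶ sHom (D.obj k) (D.obj m) :=
  mapTo (D.functor j hj) (D.functor_obj j hj k hk) (D.functor_obj j hj m hm)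

lemma val_eq_val {j l : J} (hj : j ≠ i) (hl : l ≠ i) (hkj : k.as ≠ j) (hmj : m.as ≠ j)
    (hkl : k.as ≠ l) (hml : m.as ≠ l) {T : (sHom k m).obj Δ} (h : Avoids T j) (h' : Avoids T l) :
    (D.val hj hkj hmj).app Δ T = (D.val hl hkl hml).app Δ T :=
  D.agree j l hj hl k m hkj hmj hkl hml Δ T h h'

lemma val_compSimplex {j : J} (hj : j ≠ i) (hk : k.as ≠ j) (hl : l.as ≠ j) (hm : m.as ≠ j)
    (T : (sHom k l).obj Δ) (S : (sHom l m).obj Δ) :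
    (D.val hj hk hm).app Δ (compSimplex T S) =
      compSimplex ((D.val hj hk hl).app Δ T) ((D.val hj hl hm).app Δ S) :=
  mapTo_compSimplex _ _ _ _ _ _

lemma val_eId {j : J} (hj : j ≠ i) (hk : k.as ≠ j) (x : (𝟙_ SSet.{v}).obj Δ) :
    (D.val hj hk hk).app Δ ((eId SSet k).app Δ x) = (eId SSet (D.obj k)).app Δ x :=
  mapTo_eId _ _ _

variable {a b : J} (ha : a < i) (hb : i < b)

/-- The prescribed value on the paths which contain an intermediate point `l`. -/
def split (hka : a ≤ k.as) (hkl : k.as < l.as) (hlm : l.as < m.as) (hmb : m.as ≤ b) :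
    sHom k m ⟶ sHom (D.obj k) (D.obj m) :=
  CartesianMonoidalCategory.lift
    (lower hkl.le ≫ D.val hb.ne' (hkl.trans (hlm.trans_le hmb)).ne (hlm.trans_le hmb).ne)
    (upper hlm.le ≫ D.val ha.ne (hka.trans_lt hkl).ne' (hka.trans_lt (hkl.trans hlm)).ne') ≫
    eComp SSet (D.obj k) (D.obj l) (D.obj m)

variable (hka : a ≤ k.as) (hkl : k.as < l.as) (hlm : l.as < m.as) (hmb : m.as ≤ b)

lemma split_app (T : (sHom k m).obj Δ) :
    (D.split ha hb hka hkl hlm hmb).app Δ T = compSimplex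
      ((D.val hb.ne' (hkl.trans (hlm.trans_le hmb)).ne (hlm.trans_le hmb).ne).app Δ
        ((lower hkl.le).app Δ T))
      ((D.val ha.ne (hka.trans_lt hkl).ne' (hka.trans_lt (hkl.trans hlm)).ne').app Δ
        ((upper hlm.le).app Δ T)) := rfl

/-- Such a path can be cut at `l` within the domain where index `j` is meaningful. The functor with
index `j` respects this composition, and on the lower piece it agrees with index `b`, on the upper
one with index `a`. -/
lemma split_eq_val {j : J} (hj : j ≠ i) (hk : k.as ≠ j) (hm : m.as ≠ j) {T : (sHom k m).obj Δ}
    (hl : Contains T l.as) (hT : Avoids T j) :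
    (D.split ha hb hka hkl hlm hmb).app Δ T = (D.val hj hk hm).app Δ T := by
  -- A simplex has a vertex `0`, whose path contains `l` but not `j`.
  have hlj : l.as ≠ j := fun h ↦ hT 0 (h ▸ hl 0)
  conv_rhs => rw [← compSimplex_lower_upper hkl.le hlm.le hl]
  rw [D.val_compSimplex hj hk hlj hm, split_app,
    D.val_eq_val hb.ne' hj _ _ hk hlj (avoids_of_gt _ (hlm.trans_le hmb)) (hT.lower _ hlj),
    D.val_eq_val ha.ne hj _ _ hlj hm (avoids_of_lt _ (hka.trans_lt hkl)) (hT.upper _ hlj)]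

/-- Cut the path into three pieces at `l` and `l'`. By associativity the two values differ only in
whether the middle piece is evaluated with index `a` or `b`, and that piece avoids both. -/
lemma split_eq_split_of_lt {l' : SimplicialThickening J} (hkl' : k.as < l'.as)
    (hlm' : l'.as < m.as) (hll' : l.as < l'.as) {T : (sHom k m).obj Δ} (hl : Contains T l.as)
    (hl' : Contains T l'.as) :
    (D.split ha hb hka hkl hlm hmb).app Δ T = (D.split ha hb hka hkl' hlm' hmb).app Δ T := by
  have h₁ := compSimplex_lower_upper hll'.le hlm'.le (hl'.upper hlm.le hll'.le)
  have h₂ := compSimplex_lower_upper hkl.le hll'.le (hl.lower hkl'.le hll'.le)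
  rw [upper_upper _ _ hll'.le] at h₁
  rw [lower_lower _ _ hll'.le, upper_lower _ hlm.le] at h₂
  have h₃ := (D.val_compSimplex ha.ne (hka.trans_lt hkl).ne' (hka.trans_lt hkl').ne'
    (hka.trans_lt (hkl.trans hlm)).ne' _ _).symm.trans (congr_arg _ h₁)
  have h₄ := (D.val_compSimplex hb.ne' (hkl.trans (hlm.trans_le hmb)).ne (hlm.trans_le hmb).ne
    (hlm'.trans_le hmb).ne _ _).symm.trans (congr_arg _ h₂)
  rw [split_app, split_app, ← h₃, ← h₄, compSimplex_assoc]
  congr 2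
  exact D.val_eq_val _ _ _ _ _ _ (avoids_of_lt _ (hka.trans_lt hkl))
    (avoids_of_gt _ (hlm'.trans_le hmb))

lemma split_eq_split {l' : SimplicialThickening J} (hkl' : k.as < l'.as)
    (hlm' : l'.as < m.as) {T : (sHom k m).obj Δ} (hl : Contains T l.as)
    (hl' : Contains T l'.as) :
    (D.split ha hb hka hkl hlm hmb).app Δ T = (D.split ha hb hka hkl' hlm' hmb).app Δ T := by
  obtain h | h | h := lt_trichotomy l.as l'.as
  · exact D.split_eq_split_of_lt _ _ _ _ _ _ _ _ h hl hl'
  · obtain rfl : l = l' := by cases l; cases l'; cases h; rfl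
    rfl
  · exact (D.split_eq_split_of_lt _ _ _ _ _ _ _ _ h hl' hl).symm

/-! ### Extension over the cube, face by face -/

variable (μ : ∀ X Y : C, (sHom X Y).MalcevOperation)

include μ in
/-- Extension to the mapping space between the extremal points, on the faces of the cube which
consist of the paths containing a given point. -/
lemma exists_split [DecidableEq (SimplicialThickening J)] (s : Finset (SimplicialThickening J)) :
    ∃ F : sHom (SimplicialThickening.mk a) (SimplicialThickening.mk b) ⟶
        sHom (D.obj (SimplicialThickening.mk a)) (D.obj (SimplicialThickening.mk b)),
      ∀ l ∈ insert (SimplicialThickening.mk i) s, ∀ (hal : a < l.as) (hlb : l.as < b)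
        (Δ : SimplexCategoryᵒᵖ)
        (T : (sHom (SimplicialThickening.mk a) (SimplicialThickening.mk b)).obj Δ),
          Contains T l.as → F.app Δ T = (D.split ha hb le_rfl hal hlb le_rfl).app Δ T := by
  induction s using Finset.induction_on with
  | empty =>
    -- `lower` and `upper` insert the cutting point, so the value prescribed through `i` makes sense
    -- on the whole cube and can start the induction.
    refine ⟨D.split (l := SimplicialThickening.mk i) ha hb le_rfl ha hb le_rfl, fun l hl ↦ ?_⟩
    obtain rfl : l = SimplicialThickening.mk i := by simpa using hl
    intros; rfl
  | insert l s _ ih =>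
    obtain ⟨F, hF⟩ := ih
    by_cases hl : a < l.as ∧ l.as < b
    · obtain ⟨F', h₁, h₂⟩ := (μ _ _).exists_glue F (D.split ha hb le_rfl hl.1 hl.2 le_rfl)
        (addPoint hl.1.le hl.2.le)
      refine ⟨F', fun l' hl' hal' hlb' Δ T hT ↦ ?_⟩
      rw [Finset.insert_comm] at hl'
      obtain rfl | hl' := Finset.mem_insert.1 hl'
      · exact h₂ Δ T (addPoint_of_contains _ _ hT)
      -- Adding `l` to a path through `l'` gives a path through both, where the two prescriptions
      -- coincide.
      · rw [h₁, hF l' hl' hal' hlb' Δ T hT]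
        rw [hF l' hl' hal' hlb' _ _ (hT.addPoint _ _)]
        exact D.split_eq_split _ _ _ _ _ _ _ _ (hT.addPoint _ _) (contains_addPoint _ _ _)
    · refine ⟨F, fun l' hl' hal' hlb' Δ T hT ↦ ?_⟩
      rw [Finset.insert_comm] at hl'
      obtain rfl | hl' := Finset.mem_insert.1 hl'
      · exact (hl ⟨hal', hlb'⟩).elim
      · exact hF l' hl' hal' hlb' Δ T hT

include μ in
/-- Extension to the mapping space between the extremal points, on all the faces of the cube
where values are prescribed. -/
lemma exists_extremal [Finite J] (s : Finset J) :
    ∃ F : sHom (SimplicialThickening.mk a) (SimplicialThickening.mk b) ⟶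
        sHom (D.obj (SimplicialThickening.mk a)) (D.obj (SimplicialThickening.mk b)),
      (∀ (l : SimplicialThickening J) (hal : a < l.as) (hlb : l.as < b) (Δ : SimplexCategoryᵒᵖ)
        (T : (sHom (SimplicialThickening.mk a) (SimplicialThickening.mk b)).obj Δ),
          Contains T l.as → F.app Δ T = (D.split ha hb le_rfl hal hlb le_rfl).app Δ T) ∧
      ∀ j ∈ s, ∀ (hj : j ≠ i) (hja : a ≠ j) (hjb : b ≠ j) (Δ : SimplexCategoryᵒᵖ)
        (T : (sHom (SimplicialThickening.mk a) (SimplicialThickening.mk b)).obj Δ), Avoids T j →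
          F.app Δ T = (D.val hj hja hjb).app Δ T := by
  classical
  induction s using Finset.induction_on with
  | empty =>
    have : Finite (SimplicialThickening J) :=
      Finite.of_injective (fun l ↦ l.as) (by rintro ⟨x⟩ ⟨y⟩ h; cases h; rfl)
    have := Fintype.ofFinite (SimplicialThickening J)
    obtain ⟨F, hF⟩ := D.exists_split ha hb μ Finset.univ
    exact ⟨F, fun l ↦ hF l (by simp), by simp⟩
  | insert j s _ ih =>
    obtain ⟨F, hF, hF'⟩ := ih
    by_cases hj : j ≠ i ∧ a ≠ j ∧ b ≠ j
    · obtain ⟨hji, hja, hjb⟩ := hj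
      -- The endomorphism replaces `j` by `i`: it fixes the paths avoiding `j`, and all its values
      -- avoid `j`.
      obtain ⟨F', h₁, h₂⟩ := (μ _ _).exists_glue F (D.val hji hja hjb)
        (movePoint (l := SimplicialThickening.mk i) j hja hjb ha.le hb.le)
      have hav {Δ} (T : (sHom (SimplicialThickening.mk a) (SimplicialThickening.mk b)).obj Δ) :=
        avoids_movePoint (l := SimplicialThickening.mk i) hja hjb ha.le hb.le hji.symm T
      refine ⟨F', fun l hal hlb Δ T hT ↦ ?_, fun j' hj' hji' hja' hjb' Δ T hT ↦ ?_⟩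
      · rw [h₁, hF l hal hlb Δ T hT]
        -- If `l = j`, the moved path goes through `i`; otherwise it still goes through `l`. Either
        -- way it lies in a face through a point and avoids `j`, so `split_eq_val` gives the
        -- agreement.
        by_cases hlj : l.as = j
        · subst hlj
          have := hT.movePoint_self (l := SimplicialThickening.mk i) hja hjb ha.le hb.le
          rw [hF (SimplicialThickening.mk i) ha hb _ _ this]
          exact D.split_eq_val _ _ _ _ _ _ _ _ _ this (hav T)
        · have := hT.movePoint (l := SimplicialThickening.mk i) hja hjb ha.le hb.le hlj
          rw [hF l hal hlb _ _ this]
          exact D.split_eq_val _ _ _ _ _ _ _ _ _ this (hav T)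
      · obtain rfl | hj' := Finset.mem_insert.1 hj'
        · exact h₂ Δ T (movePoint_of_avoids _ _ _ _ hT)
        · rw [h₁, hF' j' hj' hji' hja' hjb' Δ T hT]
          -- Only `i` is added and `j' ≠ i`, so the moved path still avoids `j'`.
          have := hT.movePoint (l := SimplicialThickening.mk i) hja hjb ha.le hb.le hji'.symm
          rw [hF' j' hj' hji' hja' hjb' _ _ this]
          exact D.val_eq_val _ _ _ _ _ _ this (hav T)
    · refine ⟨F, hF, fun j' hj' hji' hja' hjb' Δ T hT ↦ ?_⟩
      obtain rfl | hj' := Finset.mem_insert.1 hj'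
      · exact (hj ⟨hji', hja', hjb'⟩).elim
      · exact hF' j' hj' hji' hja' hjb' Δ T hT

include μ in
-- Only the mapping space from `a` to `b` requires gluing. If `k ≤ m` is any other pair, all paths
-- avoid `a` or all avoid `b`, and the functor with that index supplies the map; if `k > m`, the
-- mapping space is empty.
lemma exists_map [Finite J] (hJ : ∀ x, a ≤ x ∧ x ≤ b) (k m : SimplicialThickening J) :
    ∃ F : sHom k m ⟶ sHom (D.obj k) (D.obj m),
      (∀ (l : SimplicialThickening J) (hkl : k.as < l.as) (hlm : l.as < m.as)
        (Δ : SimplexCategoryᵒᵖ) (T : (sHom k m).obj Δ), Contains T l.as →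
          F.app Δ T = (D.split ha hb (hJ _).1 hkl hlm (hJ _).2).app Δ T) ∧
      ∀ (j : J) (hj : j ≠ i) (hk : k.as ≠ j) (hm : m.as ≠ j) (Δ : SimplexCategoryᵒᵖ)
        (T : (sHom k m).obj Δ), Avoids T j → F.app Δ T = (D.val hj hk hm).app Δ T := by
  have aux (j : J) (hj : j ≠ i) (hk : k.as ≠ j) (hm : m.as ≠ j)
      (H : ∀ (Δ : SimplexCategoryᵒᵖ) (T : (sHom k m).obj Δ), Avoids T j) :
      ∃ F : sHom k m ⟶ sHom (D.obj k) (D.obj m),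
      (∀ (l : SimplicialThickening J) (hkl : k.as < l.as) (hlm : l.as < m.as)
        (Δ : SimplexCategoryᵒᵖ) (T : (sHom k m).obj Δ), Contains T l.as →
          F.app Δ T = (D.split ha hb (hJ _).1 hkl hlm (hJ _).2).app Δ T) ∧
      ∀ (j : J) (hj : j ≠ i) (hk : k.as ≠ j) (hm : m.as ≠ j) (Δ : SimplexCategoryᵒᵖ)
        (T : (sHom k m).obj Δ), Avoids T j → F.app Δ T = (D.val hj hk hm).app Δ T :=
    ⟨D.val hj hk hm, fun l hkl hlm Δ T hT ↦ (D.split_eq_val _ _ _ _ _ _ _ _ _ hT (H Δ T)).symm,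
      fun j' hj' hk' hm' Δ T hT ↦ D.val_eq_val _ _ _ _ _ _ (H Δ T) hT⟩
  by_cases hkm : k.as ≤ m.as
  · by_cases hka : k.as = a
    · by_cases hmb : m.as = b
      · cases k; cases m; cases hka; cases hmb
        have := Fintype.ofFinite J
        obtain ⟨F, h₁, h₂⟩ := D.exists_extremal ha hb μ Finset.univ
        exact ⟨F, h₁, fun j ↦ h₂ j (Finset.mem_univ j)⟩
      · have hmb' := lt_of_le_of_ne (hJ m.as).2 hmb
        exact aux b hb.ne' (hkm.trans_lt hmb').ne hmb fun Δ T ↦ avoids_of_gt T hmb'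
    · have hka' := lt_of_le_of_ne (hJ k.as).1 (Ne.symm hka)
      exact aux a ha.ne hka (hka'.trans_le hkm).ne' fun Δ T ↦ avoids_of_lt T hka'
  · have hE {Δ : SimplexCategoryᵒᵖ} (T : (sHom k m).obj Δ) : False :=
      hkm (le_of_mem_support T 0 (right_mem_support T 0))
    exact ⟨{ app := fun Δ ↦ ↾fun T ↦ (hE T).elim
             naturality := fun Δ Δ' θ ↦ by ext T; exact (hE T).elim },
      fun _ _ _ _ T ↦ (hE T).elim, fun _ _ _ _ _ T ↦ (hE T).elim⟩

include μ ha hb in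
/-- A compatible family extends to an enriched functor. -/
theorem exists_functor [Finite J] (hJ : ∀ x, a ≤ x ∧ x ≤ b) :
    ∃ (F : EnrichedFunctor SSet (SimplicialThickening J) C) (hF : ∀ k, F.obj k = D.obj k),
      ∀ (k m : SimplicialThickening J) (j : J) (hj : j ≠ i) (hk : k.as ≠ j) (hm : m.as ≠ j)
        (Δ : SimplexCategoryᵒᵖ) (T : (sHom k m).obj Δ), Avoids T j →
          (mapTo F (hF k) (hF m)).app Δ T = (D.val hj hk hm).app Δ T := by
  choose Φ hΦ₁ hΦ₂ using D.exists_map ha hb μ hJ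
  have hid (k) (Δ) (x : (𝟙_ SSet.{v}).obj Δ) :
      (Φ k k).app Δ ((eId SSet k).app Δ x) = (eId SSet (D.obj k)).app Δ x := by
    -- One of `a` and `b` differs from `k`; the identity path `{k}` avoids it.
    obtain ⟨j, hj, hkj⟩ : ∃ j, j ≠ i ∧ k.as ≠ j := by
      by_cases h : k.as = a
      · exact ⟨b, hb.ne', h ▸ (ha.trans hb).ne⟩
      · exact ⟨a, ha.ne, h⟩
    rw [hΦ₂ k k j hj hkj hkj Δ _ fun p hp ↦ hkj (by rw [support_eId] at hp; exact hp.symm)]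
    exact D.val_eId _ _ _
  have hcomp (k l m) (Δ) (T : (sHom k l).obj Δ) (S : (sHom l m).obj Δ) :
      (Φ k m).app Δ (compSimplex T S) =
        compSimplex ((Φ k l).app Δ T) ((Φ l m).app Δ S) := by
    -- The mapping space from `k` to itself is a point. This settles composition with an endpoint
    -- repeated, where `split` is not available.
    have hid' (k : SimplicialThickening J) (U : (sHom k k).obj Δ) :
        ∃ x, U = (eId SSet k).app Δ x :=
      ⟨PUnit.unit, simplex_ext fun p ↦ by
        rw [support_eId]
        ext y
        have := @le_of_mem_support _ _ _ _ _ U p y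
        have := @le_of_mem_support' _ _ _ _ _ U p y
        have := left_mem_support U p
        rw [Set.mem_singleton_iff]
        grind⟩
    have hkl := le_of_mem_support T 0 (right_mem_support T 0)
    have hlm := le_of_mem_support S 0 (right_mem_support S 0)
    obtain hkl | hkl := hkl.eq_or_lt
    · obtain rfl : k = l := by cases k; cases l; cases hkl; rfl
      obtain ⟨x, rfl⟩ := hid' _ T
      rw [hid, eId_compSimplex, eId_compSimplex]
    obtain hlm | hlm := hlm.eq_or_lt
    · obtain rfl : l = m := by cases l; cases m; cases hlm; rfl
      obtain ⟨x, rfl⟩ := hid' _ S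
      rw [hid, compSimplex_eId, compSimplex_eId]
    -- The composite passes through `l`, so its value is the split one. The lower piece avoids `b`
    -- and the upper one avoids `a`, so the two factors are the values of `Φ`.
    rw [hΦ₁ k m l hkl hlm Δ (compSimplex T S) fun p ↦ Or.inl (right_mem_support T p), split_app,
      lower_compSimplex, upper_compSimplex,
      hΦ₂ k l b _ _ _ _ T (avoids_of_gt _ (hlm.trans_le (hJ _).2)),
      hΦ₂ l m a _ _ _ _ S (avoids_of_lt _ ((hJ _).1.trans_lt hkl))]
  refine ⟨{ obj := D.obj
            map := Φ
            map_id := fun k ↦ by ext Δ x; exact hid k Δ x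
            map_comp := fun k l m ↦ by ext Δ ⟨T, S⟩; exact hcomp k l m Δ T S },
    fun _ ↦ rfl, fun k m j hj hk hm Δ T hT ↦ ?_⟩
  rw [mapTo_rfl]
  exact hΦ₂ k m j hj hk hm Δ T hT

end CompatibleFamily

end CategoryTheory.SimplicialThickening

/-! ### Monotone retractions onto subsets -/

lemma OrderHom.exists_retraction {J : Type*} [LinearOrder J] (R : Finset J) (hR : R.Nonempty) :
    ∃ β : J →o J, (∀ x, β x ∈ R) ∧ ∀ x ∈ R, β x = x := by
  -- The image of `x` is the largest element of `R` that is at most `x`, or the minimum of `R` if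
  -- there is none.
  have key (x : J) : ∃ y ∈ R, (y ≤ x ∧ ∀ z ∈ R, z ≤ x → z ≤ y) ∨
      ((∀ z ∈ R, x < z) ∧ ∀ z ∈ R, y ≤ z) := by
    by_cases h : (R.filter (· ≤ x)).Nonempty
    · have h' := Finset.mem_filter.1 (Finset.max'_mem _ h)
      exact ⟨_, h'.1, Or.inl ⟨h'.2, fun z hz hzx ↦ Finset.le_max' _ z (by simp [hz, hzx])⟩⟩
    · refine ⟨_, R.min'_mem hR, Or.inr ⟨fun z hz ↦ ?_, fun z hz ↦ R.min'_le z hz⟩⟩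
      by_contra hzx
      exact h ⟨z, by simp [hz, not_lt.1 hzx]⟩
  choose β hβ hβ' using key
  refine ⟨⟨β, fun x y hxy ↦ ?_⟩, hβ, fun x hx ↦ ?_⟩
  · obtain ⟨hx, hx'⟩ | ⟨hx, hx'⟩ := hβ' x
    · obtain ⟨hy, hy'⟩ | ⟨hy, hy'⟩ := hβ' y
      · exact hy' _ (hβ x) (hx.trans hxy)
      · exact ((hy _ (hβ x)).trans_le (hx.trans hxy)).false.elim
    · exact hx' _ (hβ y)
  · obtain ⟨h, h'⟩ | ⟨h, h'⟩ := hβ' x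
    · exact le_antisymm h (h' x hx le_rfl)
    · exact (h x hx).false.elim

/-! ### From a horn to a compatible family -/

namespace CategoryTheory.SimplicialNerve

open SimplicialThickening SSet

variable {C : Type u} [Category.{v} C] [SimplicialCategory C] {n : ℕ} {i : Fin (n + 3)}
  (σ₀ : (Λ[n + 2, i] : SSet.{max u v}) ⟶ SimplicialNerve C)

/-- A simplex of the horn, given by a simplicial operator which misses a vertex `j ≠ i`. -/
def hornSimplex {n : ℕ} {i : Fin (n + 3)} {m : ℕ} (α : ⦋m⦌ ⟶ ⦋n + 2⦌)
    (h : ∃ j, j ≠ i ∧ ∀ x, α.toOrderHom x ≠ j) :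
    (Λ[n + 2, i] : SSet.{u}).obj (op ⦋m⦌) :=
  ⟨stdSimplex.objEquiv.symm α, (mem_horn_iff_notMem_range _ _).2 (by
    obtain ⟨j, hj, hj'⟩ := h
    exact ⟨j, hj, by rintro ⟨x, hx⟩; exact hj' x hx⟩)⟩

/-- The value of a map out of a horn on a simplex, as an enriched functor. -/
def hornFunctor {m : ℕ} (α : ⦋m⦌ ⟶ ⦋n + 2⦌) (h : ∃ j, j ≠ i ∧ ∀ x, α.toOrderHom x ≠ j) :
    EnrichedFunctor SSet.{v} (SimplicialThickening (ULift.{v} (Fin (m + 1)))) C :=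
  σ₀.app (op ⦋m⦌) (hornSimplex.{max u v} α h)

lemma hornFunctor_comp {m m' : ℕ} (θ : ⦋m'⦌ ⟶ ⦋m⦌) (α : ⦋m⦌ ⟶ ⦋n + 2⦌)
    (h : ∃ j, j ≠ i ∧ ∀ x, α.toOrderHom x ≠ j) (α' : ⦋m'⦌ ⟶ ⦋n + 2⦌) (hα' : θ ≫ α = α')
    (h' : ∃ j, j ≠ i ∧ ∀ x, α'.toOrderHom x ≠ j) :
    (SimplicialThickening.functor θ.toOrderHom.uliftMap).comp SSet (hornFunctor σ₀ α h) =
      hornFunctor σ₀ α' h' := by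
  subst hα'
  exact (NatTrans.naturality_apply σ₀ θ.op (hornSimplex.{max u v} α h)).symm

/-- There are at least three vertices, so some vertex differs from both `i` and `k`; hence every
vertex of the simplex lies in the horn. -/
lemma exists_ne_const (k : Fin (n + 3)) :
    ∃ j, j ≠ i ∧ ∀ x, (SimplexCategory.const ⦋0⦌ ⦋n + 2⦌ k).toOrderHom x ≠ j := by
  have : ({i, k} : Finset (Fin (n + 3))) ≠ Finset.univ := fun h ↦ by
    have := congr_arg Finset.card h
    have := Finset.card_le_two (a := i) (b := k)
    simp at *
    lia
  obtain ⟨j, hj⟩ := by simpa only [ne_eq, Finset.eq_univ_iff_forall, not_forall] using this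
  simp only [Finset.mem_insert, Finset.mem_singleton, not_or] at hj
  exact ⟨j, hj.1, fun _ ↦ Ne.symm hj.2⟩

/-- The value of a map out of a horn on a vertex, as an object. -/
def hornObj (k : Fin (n + 3)) : C :=
  (hornFunctor σ₀ (SimplexCategory.const ⦋0⦌ ⦋n + 2⦌ k) (exists_ne_const k)).obj ⟨⟨0⟩⟩

/-- Restricting to the vertex `k` shows that the object depends only on the image of `k` under `α`.
-/
lemma hornFunctor_obj {m : ℕ} (α : ⦋m⦌ ⟶ ⦋n + 2⦌) (h : ∃ j, j ≠ i ∧ ∀ x, α.toOrderHom x ≠ j)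
    (k : SimplicialThickening (ULift.{v} (Fin (m + 1)))) :
    (hornFunctor σ₀ α h).obj k = hornObj σ₀ (α.toOrderHom k.as.down) := by
  rw [hornObj, ← hornFunctor_comp σ₀ (SimplexCategory.const ⦋0⦌ ⦋m⦌ k.as.down) α h]
  · rfl
  · rfl

lemma exists_retraction (R : Finset (Fin (n + 3))) (hR : R.Nonempty) :
    ∃ β : ⦋n + 2⦌ ⟶ ⦋n + 2⦌, (∀ x, β.toOrderHom x ∈ R) ∧ ∀ x ∈ R, β.toOrderHom x = x := by
  obtain ⟨β, h, h'⟩ := OrderHom.exists_retraction R hR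
  exact ⟨SimplexCategory.mkHom β, h, h'⟩

/-- A retraction of the ordinal onto the complement of a point. -/
noncomputable def avoid (j : Fin (n + 3)) : ⦋n + 2⦌ ⟶ ⦋n + 2⦌ :=
  -- Addition in `Fin (n + 3)` is cyclic, so `j + 1` is a vertex different from `j` even when `j` is
  -- the last one.
  (exists_retraction {j}ᶜ ⟨j + 1, by simp⟩).choose

lemma avoid_ne (j x : Fin (n + 3)) : (avoid j).toOrderHom x ≠ j := by
  have := (exists_retraction {j}ᶜ ⟨j + 1, by simp⟩).choose_spec.1 x
  rwa [Finset.mem_compl, Finset.mem_singleton] at this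

lemma avoid_of_ne {j x : Fin (n + 3)} (h : x ≠ j) : (avoid j).toOrderHom x = x :=
  (exists_retraction {j}ᶜ ⟨j + 1, by simp⟩).choose_spec.2 x (by simpa using h)

/-- Hence the functor attached to `avoid j` restricts along `θ` to the value of the horn on `θ`. -/
lemma comp_avoid {m : ℕ} (θ : ⦋m⦌ ⟶ ⦋n + 2⦌) (j : Fin (n + 3)) (h : ∀ x, θ.toOrderHom x ≠ j) :
    θ ≫ avoid j = θ := by
  ext x : 3
  exact avoid_of_ne (h x)

/-- The functors given by the faces of a horn. -/
noncomputable def hornFamily : CompatibleFamily (ULift.up.{v} i) C where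
  obj k := hornObj σ₀ k.as.down
  -- A degenerate simplex of the face opposite `j`: all indices then give functors on the same
  -- thickening, without reindexing the complement of `j`.
  functor j hj := hornFunctor σ₀ (avoid j.down)
    ⟨j.down, fun h ↦ hj (ULift.ext _ _ h), avoid_ne j.down⟩
  functor_obj j hj k hk := by
    rw [hornFunctor_obj, avoid_of_ne fun h ↦ hk (ULift.ext _ _ h)]
  agree j l hj hl k m hkj hmj hkl hml Δ T hT hT' := by
    -- The retraction `β` fixes every path that avoids `j` and `l`. Since `β ≫ avoid j = β = β ≫
    -- avoid l`, both functors restrict along `β` to the value of the horn on `β`.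
    obtain ⟨β, hβ, hβ'⟩ := exists_retraction (Finset.univ.filter fun x ↦ x ≠ j.down ∧ x ≠ l.down)
      ⟨k.as.down, by
        simpa using And.intro (fun h ↦ hkj (ULift.ext _ _ h)) (fun h ↦ hkl (ULift.ext _ _ h))⟩
    have hβj (x) : β.toOrderHom x ≠ j.down := (Finset.mem_filter.1 (hβ x)).2.1
    have hβl (x) : β.toOrderHom x ≠ l.down := (Finset.mem_filter.1 (hβ x)).2.2
    have hfix (x : ULift.{v} (Fin (n + 3))) (hj : x ≠ j) (hl : x ≠ l) :
        β.toOrderHom.uliftMap x = x :=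
      ULift.ext _ _ (hβ' x.down (Finset.mem_filter.2 ⟨Finset.mem_univ _,
        fun h ↦ hj (ULift.ext _ _ h), fun h ↦ hl (ULift.ext _ _ h)⟩))
    have hkβ : (SimplicialThickening.functor β.toOrderHom.uliftMap).obj k = k :=
      congr_arg SimplicialThickening.mk (hfix _ hkj hkl)
    have hmβ : (SimplicialThickening.functor β.toOrderHom.uliftMap).obj m = m :=
      congr_arg SimplicialThickening.mk (hfix _ hmj hml)
    have hsupp (p) : support T p =
        support (((SimplicialThickening.functor β.toOrderHom.uliftMap).map k m).app Δ T) p := by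
      rw [support_functor_map]
      have : ∀ x ∈ support T p, β.toOrderHom.uliftMap x = x := fun x hx ↦
        hfix x (fun h ↦ hT p (h ▸ hx)) (fun h ↦ hT' p (h ▸ hx))
      rw [Set.image_congr this, Set.image_id']
    have h₁ := hornFunctor_comp σ₀ β (avoid j.down)
      ⟨j.down, fun h ↦ hj (ULift.ext _ _ h), avoid_ne j.down⟩ β (comp_avoid β _ hβj)
      ⟨j.down, fun h ↦ hj (ULift.ext _ _ h), hβj⟩
    have h₂ := hornFunctor_comp σ₀ β (avoid l.down)
      ⟨l.down, fun h ↦ hl (ULift.ext _ _ h), avoid_ne l.down⟩ β (comp_avoid β _ hβl)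
      ⟨j.down, fun h ↦ hj (ULift.ext _ _ h), hβj⟩
    have h {G : EnrichedFunctor SSet.{v} (SimplicialThickening (ULift.{v} (Fin (n + 3)))) C}
        {H} (hG : (SimplicialThickening.functor β.toOrderHom.uliftMap).comp SSet G = H)
        {X Y : C} (hX : G.obj k = X) (hY : G.obj m = Y) :
        ∃ hX' hY', (mapTo G hX hY).app Δ T = (mapTo H (X := X) (Y := Y) (k := k) (m := m)
          hX' hY').app Δ T := by
      subst hG
      refine ⟨(congr_arg G.obj hkβ).trans hX, (congr_arg G.obj hmβ).trans hY, ?_⟩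
      rw [mapTo_comp_functor]
      exact mapTo_eq_of_support_eq _ _ hkβ.symm hmβ.symm rfl _ _ _ _ _ _ hsupp
    obtain ⟨_, _, e₁⟩ := h h₁ ((hornFunctor_obj ..).trans (congr_arg _ (avoid_of_ne fun h ↦
      hkj (ULift.ext _ _ h)))) ((hornFunctor_obj ..).trans (congr_arg _ (avoid_of_ne fun h ↦
      hmj (ULift.ext _ _ h))))
    obtain ⟨_, _, e₂⟩ := h h₂ ((hornFunctor_obj ..).trans (congr_arg _ (avoid_of_ne fun h ↦
      hkl (ULift.ext _ _ h)))) ((hornFunctor_obj ..).trans (congr_arg _ (avoid_of_ne fun h ↦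
      hml (ULift.ext _ _ h))))
    exact e₁.trans e₂.symm

/-- The homotopy coherent nerve of a simplicial category is a quasicategory as soon as the
mapping spaces have Mal'cev operations. -/
theorem quasicategory_of_malcevOperation (μ : ∀ X Y : C, (sHom X Y).MalcevOperation) :
    Quasicategory (SimplicialNerve C) := by
  refine quasicategory_of_filler _ fun n i σ₀ h0 hn ↦ ?_
  -- The horn is inner, so `i` lies strictly between the extremal vertices `0` and `n + 2`.
  obtain ⟨F, hF, hF'⟩ := (hornFamily σ₀).exists_functor (a := ⟨0⟩) (b := ⟨Fin.last (n + 2)⟩)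
    h0 hn μ fun x ↦ ⟨Fin.zero_le x.down, Fin.le_last x.down⟩
  refine ⟨F, fun j hj ↦ ?_⟩
  have hδ (x) : (SimplexCategory.δ j).toOrderHom x ≠ j := Fin.succAbove_ne j x
  have hface : horn.face i j hj = hornSimplex.{max u v} (SimplexCategory.δ j) ⟨j, hj, hδ⟩ := rfl
  change (SimplicialThickening.functor (SimplexCategory.δ j).toOrderHom.uliftMap).comp SSet F =
    σ₀.app _ (horn.face i j hj)
  rw [hface]
  change _ = hornFunctor σ₀ _ _
  -- The prescribed face is rewritten as the restriction along `δ j` of the family's functor with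
  -- index `j`. It remains to compare that functor with `F` on paths in the image of `δ j`, all of
  -- which avoid `j`.
  rw [← hornFunctor_comp σ₀ (SimplexCategory.δ j) (avoid j) ⟨j, hj, avoid_ne j⟩ _
    (comp_avoid _ _ hδ)]
  have hne (k : ULift.{v} (Fin (n + 2))) : (SimplexCategory.δ j).toOrderHom.uliftMap k ≠ ⟨j⟩ :=
    fun h ↦ hδ k.down (congr_arg ULift.down h)
  have hj' : ULift.up j ≠ ULift.up i := fun h ↦ hj (congr_arg ULift.down h)
  refine ext_of_mapTo (fun k ↦ hF _)
    (fun k ↦ (hornFamily σ₀).functor_obj ⟨j⟩ hj' _ (hne k.as)) fun k m Δ T ↦ ?_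
  refine (mapTo_comp_functor ..).trans (Eq.trans ?_ (mapTo_comp_functor ..).symm)
  refine hF' _ _ ⟨j⟩ hj' (hne k.as) (hne m.as) Δ _ fun p hp ↦ ?_
  obtain ⟨x, -, hx⟩ := (support_functor_map _ T p).subset hp
  exact hne x hx

end CategoryTheory.SimplicialNerve

/-! ### The case of DG-categories -/

/-- The Mal'cev operation `x + y - z` of a simplicial abelian group. -/
def SSet.malcevOperationOfAddCommGrp (G : SimplicialObject AddCommGrpCat.{v}) :
    SSet.MalcevOperation (((SimplicialObject.whiskering _ _).obj (forget AddCommGrpCat.{v})).obj G)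
    where
  op {Δ} x y z :=
    letI x' : G.obj Δ := x
    letI y' : G.obj Δ := y
    letI z' : G.obj Δ := z
    (x' + y' - z' : G.obj Δ)
  map_op {Δ Δ'} θ x y z := by
    change (G.map θ).hom _ = _
    exact (map_sub (G.map θ).hom _ _).trans (congr_arg (· - _) (map_add (G.map θ).hom _ _))
  op_right {Δ} x y := add_sub_cancel_right (G := G.obj Δ) x y
  op_outer {Δ} x y := add_sub_cancel_left (G := G.obj Δ) x y

/-- The mapping spaces are by construction the underlying simplicial sets of simplicial abelian
groups, which supplies the operation. -/
theorem proposition3p3 (A : Type u) [DGCategory.{v} A] :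
    SSet.Quasicategory (DGCategory.coherentNerve A) :=
  SimplicialNerve.quasicategory_of_malcevOperation (C := ForgetEnrichment SSet.{v} A)
    fun X Y ↦ SSet.malcevOperationOfAddCommGrp
      (Abelian.DoldKan.Γ.obj (DGCategory.trunc
        (DGCategory.Hom (ForgetEnrichment.to SSet.{v} X) (ForgetEnrichment.to SSet.{v} Y))))
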